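/- **Setting.** Fix integers $K\ge 0$, $M\ge 1$, put $\varepsilon=1/M$ and let $B$ be the set of non-decreasing vectors $\mathbf b=(b_1\le\dots\le b_K)$ with entries in the price grid $\{0,\varepsilon,2\varepsilon,\dots,1\}$. In the uniform-price auction for $K$ units the principal bids $\mathbf b\in B$ against opposing bids $\boldsymbol\beta\in B$. The price $p(\mathbf b,\boldsymbol\beta)$ is the $K$-th lowest of the $2K$ bids, and the principal sells $$x(\mathbf b,\boldsymbol\beta)=\min\bigl(\#\{k: b_k\le p\},\ K-\#\{k:\beta_k<p\}\bigr)$$ units (all its bids up to the price, within the demand $K$, ties with opponents being broken in its favour). With marginal costs $c_1,\dots,c_K\in[0,1]$ its utility is $u(\mathbf b,\boldsymbol\beta)=\sum_{l=1}^{x(\mathbf b,\boldsymbol\beta)}(p(\mathbf b,\boldsymbol\beta)-c_l)$. **Transformed action space.** Let $\mathbf h(\mathbf b)\in\{0,1\}^N$ have the coordinates $h_{k,q}=\mathbb 1\{b_k=q\}$ ($1\le k\le K$, $q$ in the grid) and $h_{k+1/2,q}=\mathbb 1\{b_k\le q<q+\varepsilon\le b_{k+1}\}$ ($1\le k\le K-1$,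 $q\ne1$ in the grid), and let $\mathcal H=\mathbf h(B)$. A *weight map* is a map $\mathbf W:B\to[-K,K]^N$ with $u(\mathbf b,\boldsymbol\beta)=\langle\mathbf h(\mathbf b),\mathbf W(\boldsymbol\beta)\rangle$ for all $\mathbf b,\boldsymbol\beta\in B$. **Algorithm.** Parameters: $\gamma\in(0,1]$, a weight map $\mathbf W$, and a sampling scheme $P$, i.e. for each $x\in\mathrm{Conv}(\mathcal H)$ a distribution $P(x)$ on $B$ with $\mathbb E_{\mathbf b\sim P(x)}[\mathbf h(\mathbf b)]=x$. Let $\Psi_\gamma(x)=\sum_{i=1}^N\bigl(-\sqrt{x_i}+\gamma(1-x_i)\log(1-x_i)\bigr)$, with $0\log 0=0$, let $\eta_t=1/\sqrt t$ and $\hat W_0=0$. In round $t=1,2,\dots$ compute $x_t=\arg\min_{x\in\mathrm{Conv}(\mathcal H)}\langle x,\hat W_{t-1}\rangle+\eta_t^{-1}\Psi_\gamma(x)$, draw $\mathbf b^t\sim P(x_t)$, observe the semi-bandit outcomes $y_{t,i}=h_i(\mathbf b^t)W_i(\boldsymbol\beta^t)$, form the loss estimates $$\hat w_{t,i}=\frac{(-y_{t,i}+K)\,h_i(\mathbf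 b^t)}{x_{t,i}}-K,$$ and set $\hat W_t=\hat W_{t-1}+\hat w_t$. **Theorem.** 1. *(The algorithm is well posed and needs bandit feedback only.)* For all costs in $[0,1]$ the following two maps are weight maps. * Event weights: $W_{m,q}(\boldsymbol\beta)=\sum_{l\le m}(q-c_l)$ if $\beta_{K-m}<q\le\beta_{K-m+1}$ (with no lower bound on $q$ if $m=K$), $W_{m+1/2,q}(\boldsymbol\beta)=\sum_{l\le m}(q-c_l)$ if $q=\beta_{K-m}$, and $0$ otherwise. * Increment weights: $W_{m,q}(\boldsymbol\beta)=(q-c_m)\,\mathbb 1\{q\le\beta_{K-m+1}\}$, $W_{m+1/2,q}(\boldsymbol\beta)=m\varepsilon\,\mathbb 1\{q+\varepsilon\le\beta_{K-m}\}$. For the increment weights the outcomes $h_i(\mathbf b)W_i(\boldsymbol\beta)$ are a function of $\mathbf b$, the price $p(\mathbf b,\boldsymbol\beta)$ and the allocation $x(\mathbf b,\boldsymbol\beta)$ only. 2. *(Stochastic opposing bids.)* Let the costs lie in $[0,1]$ and let $\boldsymbol\beta^1,\boldsymbol\beta^2,\dots$ be i.i.d. from a distribution $\mathcal D$ on $B$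 for which $\mathbf b\mapsto\mathbb E_{\boldsymbol\beta\sim\mathcal D}[u(\mathbf b,\boldsymbol\beta)]$ has a unique maximizer. There is a constant $C$, depending only on $K,M,\gamma$, the costs and $\mathcal D$, such that for every weight map, every sampling scheme and every $T\ge2$ $$\tilde R_T=T\sup_{\mathbf b\in B}\mathbb E_{\boldsymbol\beta\sim\mathcal D}[u(\mathbf b,\boldsymbol\beta)]-\mathbb E\Bigl[\sum_{t=1}^Tu(\mathbf b^t,\boldsymbol\beta^t)\Bigr]\le C\log T .$$ 3. *(Adversarial opposing bids.)* There is a constant $C$, depending only on $K,M,\gamma$, such that for all costs in $[0,1]$, every weight map, every sampling scheme, every fixed sequence $(\boldsymbol\beta^t)_{t\ge1}$ in $B$ and every $T\ge1$ $$R_T=\sup_{\mathbf b\in B}\mathbb E\Bigl[\sum_{t=1}^Tu(\mathbf b,\boldsymbol\beta^t)-\sum_{t=1}^Tu(\mathbf b^t,\boldsymbol\beta^t)\Bigr]\le C\sqrt T .$$ -/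

import Mathlib

open scoped BigOperators

noncomputable section

namespace FCR

/-! ### The uniform-price auction -/

/-- The set `B` of bid vectors: non-decreasing `K`-tuples of prices on the uniform grid
`{0, 1/M, 2/M, …, 1}`.  Prices are stored in grid units, so `v` stands for the price `v / M`;
unit number `k + 1` of the auction is the index `k : Fin K`. -/
def Bid (K M : ℕ) : Type := {b : Fin K → Fin (M + 1) // Monotone b}

variable {K M : ℕ}

instance : Finite (Bid K M) := Subtype.finite
instance : Fintype (Bid K M) := Fintype.ofFinite _
instance : Nonempty (Bid K M) := ⟨⟨fun _ => 0, fun _ _ _ => le_rfl⟩⟩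

/-- The `k`-th entry of a bid vector, in grid units. -/
def Bid.at (b : Bid K M) (k : Fin K) : ℕ := (b.1 k : ℕ)

/-- Clearing price (in grid units): the `K`-th lowest of the `2K` bids in `(b, β)`, that is, the
least level `v` such that at least `K` of the `2K` bids are at most `v`. -/
def price (b β : Bid K M) : ℕ :=
  sInf {v : ℕ | K ≤ (Finset.univ.filter fun k => b.at k ≤ v).card
                  + (Finset.univ.filter fun k => β.at k ≤ v).card}

/-- Number of units sold by the principal: all its bids at or below the clearing price, as long as
the demand `K` is not exceeded by them together with the opposing bids strictly below the price
(ties between the principal and the opponents are broken in favour of the principal). -/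
def alloc (b β : Bid K M) : ℕ :=
  min (Finset.univ.filter fun k => b.at k ≤ price b β).card
    (K - (Finset.univ.filter fun k => β.at k < price b β).card)

/-- Quasi-linear utility of the principal with marginal costs `c`. -/
def utility (c : Fin K → ℝ) (b β : Bid K M) : ℝ :=
  ∑ l ∈ Finset.univ.filter (fun l : Fin K => (l : ℕ) < alloc b β), ((price b β : ℝ) / M - c l)

/-! ### The combinatorial reformulation -/

/-- Coordinates of the transformed action space.  `Sum.inl (k, q)` is the pair (unit `k + 1`,
price `q / M`); `Sum.inr (k, q)` is the half-step between the units `k + 1` and `k + 2`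
together with the grid transition from `q / M` to `(q + 1) / M`. -/
abbrev Coord (K M : ℕ) : Type := (Fin K × Fin (M + 1)) ⊕ (Fin (K - 1) × Fin M)

/-- For a half-step, the lower and the upper of its two units. -/
def lo (k : Fin (K - 1)) : Fin K := ⟨k, by omega⟩
def hi (k : Fin (K - 1)) : Fin K := ⟨k + 1, by omega⟩

open Classical in
/-- The encoding `h : B → {0,1}^N`: which grid price each unit is offered at, and which grid
transitions are crossed between consecutive bids. -/
def enc (b : Bid K M) : Coord K M → ℝ
  | Sum.inl (k, q) => if b.at k = q then 1 else 0
  | Sum.inr (k, q) => if b.at (lo k) ≤ q ∧ (q : ℕ) + 1 ≤ b.at (hi k) then 1 else 0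

/-- `Conv(H)`, where `H = h(B)`. -/
def convH (K M : ℕ) : Set (Coord K M → ℝ) := convexHull ℝ (Set.range (enc (K := K) (M := M)))

/-- `W : β ↦ W(β)` is a weight map for the utility: `u(b, β) = ⟨h(b), W(β)⟩` for all bids, and all
weights lie in `[-K, K]`. -/
def IsWeightMap (c : Fin K → ℝ) (W : Bid K M → Coord K M → ℝ) : Prop :=
  (∀ b β, utility c b β = ∑ i, enc b i * W β i) ∧ ∀ β i, |W β i| ≤ K

/-- Utility from selling the units `1, …, k + 1` at the price `q / M`. -/
def payoff (M : ℕ) (c : Fin K → ℝ) (k q : ℕ) : ℝ :=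
  ∑ l ∈ Finset.univ.filter (fun l : Fin K => (l : ℕ) ≤ k), ((q : ℝ) / M - c l)

open Classical in
/-- The weight map in which every coordinate stands for one outcome of the auction.  Write `m` for
the number of units concerned.  Coordinate (unit `m`, price `q`): `m` units are sold and the price
`q` is set by the principal, `β_{K-m} < q ≤ β_{K-m+1}` (no lower bound on `q` if `m = K`).
Half-step coordinate after unit `m` at level `q`: `m` units are sold and the price is set by the
opponents, `β_{K-m} = q`.  The `j`-th lowest opposing bid has index `j - 1`, so that `β_{K-m+1}` is
`β` at `Fin.rev` of the index of unit `m`. -/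
def eventWeights (c : Fin K → ℝ) (β : Bid K M) : Coord K M → ℝ
  | Sum.inl (k, q) =>
      if (∀ k' : Fin K, (k' : ℕ) = k + 1 → β.at k'.rev < q) ∧ (q : ℕ) ≤ β.at k.rev
      then payoff M c k q else 0
  | Sum.inr (k, q) => if β.at (hi k).rev = q then payoff M c k q else 0

open Classical in
/-- The weight map in which a unit sold contributes its own bid minus its cost, and every grid
transition of the price above the bid of unit `m` contributes one increment on `m` units. -/
def incrementWeights (c : Fin K → ℝ) (β : Bid K M) : Coord K M → ℝ
  | Sum.inl (k, q) => if (q : ℕ) ≤ β.at k.rev then (q : ℝ) / M - c k else 0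
  | Sum.inr (k, q) => if (q : ℕ) + 1 ≤ β.at (hi k).rev then ((k : ℝ) + 1) / M else 0

/-! ### The algorithm -/

/-- The hybrid regularizer `Ψ_γ`. -/
def regularizer (γ : ℝ) (x : Coord K M → ℝ) : ℝ :=
  ∑ i, (-√(x i) + γ * ((1 - x i) * Real.log (1 - x i)))

/-- Learning rate of round `t ≥ 1`. -/
def eta (t : ℕ) : ℝ := 1 / √(t : ℝ)

/-- The function minimized over `Conv(H)` in round `t`, given the cumulative loss estimate `L`. -/
def objective (γ : ℝ) (t : ℕ) (L x : Coord K M → ℝ) : ℝ :=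
  (∑ i, x i * L i) + (eta t)⁻¹ * regularizer γ x

theorem exists_minimizer (γ : ℝ) (t : ℕ) (L : Coord K M → ℝ) :
    ∃ x ∈ convH K M, IsMinOn (objective γ t L) (convH K M) x := by
  have hc : IsCompact (convH K M) := (Set.finite_range _).isCompact_convexHull ℝ
  have hn : (convH K M).Nonempty :=
    ⟨_, subset_convexHull ℝ _ ⟨Classical.arbitrary (Bid K M), rfl⟩⟩
  refine hc.exists_isMinOn hn (Continuous.continuousOn ?_)
  unfold objective regularizer
  have h1 : ∀ i : Coord K M,
      Continuous fun x : Coord K M → ℝ => (1 - x i) * Real.log (1 - x i) := fun i =>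
    Real.continuous_mul_log.comp (continuous_const.sub (continuous_apply i))
  have h2 : ∀ i : Coord K M, Continuous fun x : Coord K M → ℝ => √(x i) := fun i =>
    Real.continuous_sqrt.comp (continuous_apply i)
  refine Continuous.add ?_ (continuous_const.mul ?_)
  · exact continuous_finsetSum _ fun i _ => (continuous_apply i).mul continuous_const
  · exact continuous_finsetSum _ fun i _ => (h2 i).neg.add (continuous_const.mul (h1 i))

/-- The point `x_t ∈ Conv(H)` computed in round `t` (for `t ≥ 1` and `γ ≥ 0` the objective is
strictly convex on `Conv(H)`, so there is only one minimizer). -/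
def minimizer (γ : ℝ) (t : ℕ) (L : Coord K M → ℝ) : Coord K M → ℝ :=
  (exists_minimizer γ t L).choose

/-- A sampling scheme: for every `x ∈ Conv(H)` a distribution of bids `b` such that `h(b)` has
mean `x`. -/
structure SamplingScheme (K M : ℕ) where
  sample : (Coord K M → ℝ) → PMF (Bid K M)
  mean : ∀ x ∈ convH K M, ∀ i, ∑ b, (sample x b).toReal * enc b i = x i

/-- The estimate `ŵ_t` of the loss vector `-W(β^t)`, built from the point `x = x_t`, the bid
`b = b^t` and the semi-bandit outcomes `y_i = h_i(b) W_i(β^t)`. -/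
def lossEstimate (x : Coord K M → ℝ) (b : Bid K M) (y : Coord K M → ℝ) : Coord K M → ℝ :=
  fun i => (-y i + K) * enc b i / x i - K

/-- The semi-bandit outcomes: `W(β)` on the active coordinates, `0` elsewhere. -/
def outcome (W : Bid K M → Coord K M → ℝ) (b β : Bid K M) : Coord K M → ℝ :=
  fun i => enc b i * W β i

/-- The cumulative estimate `Ŵ_t` after `t` rounds, as a function of the history
`(b^1, β^1), …, (b^t, β^t)`. -/
def cumEstimate (γ : ℝ) (W : Bid K M → Coord K M → ℝ) :
    (t : ℕ) → (Fin t → Bid K M × Bid K M) → Coord K M → ℝ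
  | 0, _ => 0
  | t + 1, ω =>
      let L := cumEstimate γ W t (Fin.init ω)
      let r := ω (Fin.last t)
      L + lossEstimate (minimizer γ (t + 1) L) r.1 (outcome W r.1 r.2)

/-- The law of the first `t` rounds `(b^s, β^s)` when the bids `b^s` are chosen by the algorithm
and the opposing bids of round `s` are drawn from `env (s - 1)`, independently of the past and of
`b^s`. -/
def law (γ : ℝ) (W : Bid K M → Coord K M → ℝ) (P : SamplingScheme K M) (env : ℕ → PMF (Bid K M)) :
    (t : ℕ) → PMF (Fin t → Bid K M × Bid K M)
  | 0 => PMF.pure Fin.elim0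
  | t + 1 =>
      (law γ W P env t).bind fun ω =>
        (P.sample (minimizer γ (t + 1) (cumEstimate γ W t ω))).bind fun b =>
          (env t).bind fun β =>
            PMF.pure (Fin.snoc (α := fun _ => Bid K M × Bid K M) ω (b, β))

/-- Expectation over a finite space. -/
def expect {α : Type} [Fintype α] (p : PMF α) (f : α → ℝ) : ℝ := ∑ a, (p a).toReal * f a

/-- Regret `R_T` of the algorithm against a fixed sequence of opposing bids. -/
def regret (c : Fin K → ℝ) (γ : ℝ) (W : Bid K M → Coord K M → ℝ) (P : SamplingScheme K M)
    (β : ℕ → Bid K M) (T : ℕ) : ℝ :=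
  ⨆ b : Bid K M, expect (law γ W P (fun t => PMF.pure (β t)) T) fun ω =>
    (∑ t, utility c b (ω t).2) - ∑ t, utility c (ω t).1 (ω t).2

/-- Pseudo-regret `R̃_T` of the algorithm against opposing bids drawn independently from `D`. -/
def pseudoRegret (c : Fin K → ℝ) (γ : ℝ) (W : Bid K M → Coord K M → ℝ) (P : SamplingScheme K M)
    (D : PMF (Bid K M)) (T : ℕ) : ℝ :=
  T * (⨆ b : Bid K M, expect D fun β => utility c b β)
    - expect (law γ W P (fun _ => D) T) fun ω => ∑ t, utility c (ω t).1 (ω t).2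

end FCR

end

namespace FCR

variable {K M : ℕ}

/-! ### Counting bids and the clearing price -/

/-! The auction is linear in the encoding because unit `k` is sold exactly when its bid is at most
the opposing bid at `k.rev` (`lt_alloc_iff`), a condition free of the price. For increment weights,
the price received for a sold unit is its own bid plus the grid steps from that bid up to the price.
Abel summation collects these steps into half-step coordinates, and on an active coordinate the
opponents' bids enter only through price and allocation, so bandit feedback is enough. For event
weights, exactly one active coordinate describes the outcome whenever something is sold.

The learner is follow-the-regularized-leader with an importance-weighted, unbiased loss estimate.
The potential is the gap between the regularized cumulative loss of a comparator vertex `enc b₀` and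
the minimum. One round (`potential_succ_le`) changes it by a linear term, whose mean is minus the
regret of the round, plus a penalty for the changed learning rate, plus a stability term. Since the
minimizer is interior, stability reduces to one-coordinate estimates with the Bregman divergence:
the square root controls coordinates near `0`, the entropy of `1 - x` those near `1`. In mean,
penalty and stability are at most a constant times `√|x i - enc b₀ i| / √t`, for either value of
`enc b₀ i`.

Hence the self-bounding inequality `expect_regret_le`: regret is at most `∑ C / √t * E[vertexGap]`.
Bounding `vertexGap` by the number of coordinates gives `√T`. For i.i.d. opponents with a unique
optimum `b₀`, each coordinate is within `P(b ≠ b₀)` of its vertex value, and this probability is at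
most the expected loss of the round divided by the gap `δ`. Young's inequality then absorbs half of
the regret into the left-hand side and leaves `∑ 1 / t`. -/

theorem Bid.at_mono (b : Bid K M) {i j : Fin K} (h : i ≤ j) : b.at i ≤ b.at j := b.2 h

theorem Bid.at_le (b : Bid K M) (k : Fin K) : b.at k ≤ M := Nat.lt_succ_iff.mp (b.1 k).2

/-- Number of entries of `b` at or below the level `v`. -/
def countLE (b : Bid K M) (v : ℕ) : ℕ := (Finset.univ.filter fun k => b.at k ≤ v).card

/-- Number of entries of `b` strictly below the level `v`. -/
def countLT (b : Bid K M) (v : ℕ) : ℕ := (Finset.univ.filter fun k => b.at k < v).card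

/-- A down-closed subset of `Fin K` is an initial segment, so its cardinality is the threshold of
membership. This turns all comparisons of sorted bids into linear arithmetic on counts. -/
theorem lt_card_filter_iff {p : Fin K → Prop} [DecidablePred p]
    (hp : ∀ i j, i ≤ j → p j → p i) (k : Fin K) :
    (k : ℕ) < (Finset.univ.filter p).card ↔ p k := by
  constructor
  · intro h
    by_contra hk
    have hs : Finset.univ.filter p ⊆ Finset.Iio k := by
      intro j hj
      rw [Finset.mem_filter] at hj
      rw [Finset.mem_Iio]
      by_contra hjk
      exact hk (hp k j (not_lt.mp hjk) hj.2)
    have := Finset.card_le_card hs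
    rw [Fin.card_Iio] at this
    omega
  · intro h
    have hs : Finset.Iic k ⊆ Finset.univ.filter p := by
      intro j hj
      rw [Finset.mem_Iic] at hj
      exact Finset.mem_filter.mpr ⟨Finset.mem_univ _, hp j k hj h⟩
    have := Finset.card_le_card hs
    rw [Fin.card_Iic] at this
    omega

theorem lt_countLE_iff (b : Bid K M) (v : ℕ) (k : Fin K) :
    (k : ℕ) < countLE b v ↔ b.at k ≤ v :=
  lt_card_filter_iff (fun _ _ h => (b.at_mono h).trans) k

theorem lt_countLT_iff (b : Bid K M) (v : ℕ) (k : Fin K) :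
    (k : ℕ) < countLT b v ↔ b.at k < v :=
  lt_card_filter_iff (fun _ _ h => (b.at_mono h).trans_lt) k

theorem countLT_le (b : Bid K M) (v : ℕ) : countLT b v ≤ K :=
  (Finset.card_le_univ _).trans_eq (Fintype.card_fin K)

theorem countLT_zero (b : Bid K M) : countLT b 0 = 0 := by simp [countLT]

theorem countLT_succ (b : Bid K M) (v : ℕ) : countLT b (v + 1) = countLE b v := by
  simp only [countLT, countLE, Nat.lt_succ_iff]

theorem countLE_le_countLT (b : Bid K M) {v w : ℕ} (h : v < w) : countLE b v ≤ countLT b w :=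
  Finset.card_le_card fun _ hk => by
    rw [Finset.mem_filter] at hk ⊢
    exact ⟨hk.1, hk.2.trans_lt h⟩

theorem le_countLE_price (b β : Bid K M) :
    K ≤ countLE b (price b β) + countLE β (price b β) := by
  have hne : {v : ℕ | K ≤ countLE b v + countLE β v}.Nonempty := by
    refine ⟨M, ?_⟩
    have : countLE b M = K := by simp [countLE, Bid.at_le]
    simp only [Set.mem_ofPred_eq]
    omega
  exact Nat.sInf_mem hne

theorem countLT_price_lt (hK : 0 < K) (b β : Bid K M) :
    countLT b (price b β) + countLT β (price b β) < K := by
  rcases Nat.eq_zero_or_pos (price b β) with h | h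
  · rw [h, countLT_zero, countLT_zero]
    exact hK
  · obtain ⟨v, hv⟩ := Nat.exists_eq_succ_of_ne_zero h.ne'
    rw [hv, Nat.succ_eq_add_one, countLT_succ, countLT_succ]
    by_contra hcon
    have : price b β ≤ v := Nat.sInf_le (not_lt.mp hcon)
    omega

/-- These two inequalities characterize the clearing price, because `countLE` at a lower level is at
most `countLT` at a higher one. -/
theorem price_eq {b β : Bid K M} {v : ℕ} (h1 : K ≤ countLE b v + countLE β v)
    (h2 : countLT b v + countLT β v < K) : price b β = v := by
  refine le_antisymm (Nat.sInf_le h1) ?_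
  by_contra hcon
  have hlt := not_le.mp hcon
  have := le_countLE_price b β
  have := countLE_le_countLT b hlt
  have := countLE_le_countLT β hlt
  omega

theorem alloc_eq (b β : Bid K M) :
    alloc b β = min (countLE b (price b β)) (K - countLT β (price b β)) := rfl

theorem le_at_rev_iff (β : Bid K M) (k : Fin K) (q : ℕ) :
    q ≤ β.at k.rev ↔ countLT β q + (k + 1) ≤ K := by
  have h := lt_countLT_iff β q k.rev
  rw [Fin.val_rev] at h
  have := k.2
  omega

theorem lt_at_rev_iff (β : Bid K M) (k : Fin K) (q : ℕ) :
    q < β.at k.rev ↔ countLE β q + (k + 1) ≤ K := by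
  have h := lt_countLE_iff β q k.rev
  rw [Fin.val_rev] at h
  have := k.2
  omega

/-- Makes the utility linear: the sale of a unit is decided by one own bid and one opposing bid.
Both sides reduce to counts at the price, related by the two inequalities that define it. -/
theorem lt_alloc_iff (b β : Bid K M) (k : Fin K) :
    (k : ℕ) < alloc b β ↔ b.at k ≤ β.at k.rev := by
  have hk := k.2
  have h1 := le_countLE_price b β
  have h2 := countLT_price_lt (by omega) b β
  have a1 := lt_countLE_iff b (price b β) k
  have a2 := le_at_rev_iff β k (price b β)
  have a3 := lt_at_rev_iff β k (price b β)
  have a4 := lt_countLT_iff b (price b β) k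
  rw [alloc_eq]
  omega

theorem at_le_price_of_lt_alloc {b β : Bid K M} {k : Fin K} (h : (k : ℕ) < alloc b β) :
    b.at k ≤ price b β := by
  rw [alloc_eq] at h
  exact (lt_countLE_iff b _ k).mp (by omega)

theorem price_le_at_of_alloc_le {b β : Bid K M} {k : Fin K} (h : alloc b β ≤ k) :
    price b β ≤ b.at k := by
  have hk := k.2
  have h2 := countLT_price_lt (by omega) b β
  have a1 := lt_countLE_iff b (price b β) k
  have a4 := lt_countLT_iff b (price b β) k
  rw [alloc_eq] at h
  omega

theorem lo_val (k : Fin (K - 1)) : (lo k : ℕ) = k := rfl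

theorem hi_val (k : Fin (K - 1)) : (hi k : ℕ) = k + 1 := rfl

/-- Exactly `k + 1` own bids are at most `q`, so the price exceeds `q` iff fewer than `K - (k + 1)`
opposing bids do not exceed `q`. An unobserved opposing bid is thus replaced by the observed price.
-/
theorem succ_le_at_rev_hi_iff {b β : Bid K M} {k : Fin (K - 1)} {q : ℕ}
    (h1 : b.at (lo k) ≤ q) (h2 : q + 1 ≤ b.at (hi k)) :
    q + 1 ≤ β.at (hi k).rev ↔ q + 1 ≤ price b β := by
  have hk := k.2
  have e1 := le_countLE_price b β
  have e2 := countLT_price_lt (by omega) b β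
  have a1 := lt_countLE_iff b (price b β) (hi k)
  have a2 := lt_countLT_iff b (price b β) (lo k)
  have a3 := le_at_rev_iff β (hi k) (price b β)
  have a4 := lt_at_rev_iff β (hi k) (price b β)
  rw [hi_val] at *
  rw [lo_val] at *
  omega

/-! ### Increment weights -/

theorem sum_coord (f : Coord K M → ℝ) :
    ∑ i, f i = ∑ k, ∑ q, f (Sum.inl (k, q)) + ∑ k, ∑ q, f (Sum.inr (k, q)) := by
  rw [Fintype.sum_sum_type, Fintype.sum_prod_type, Fintype.sum_prod_type]

theorem sum_enc_inl_mul (b : Bid K M) (k : Fin K) (f : ℕ → ℝ) :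
    ∑ q : Fin (M + 1), enc b (Sum.inl (k, q)) * f q = f (b.at k) := by
  rw [Finset.sum_eq_single (b.1 k)]
  · simp [enc, Bid.at]
  · intro q _ hq
    have : ¬ b.at k = q := fun h => hq (Fin.ext h.symm)
    simp [enc, this]
  · simp

theorem utility_eq_sum_ite (c : Fin K → ℝ) (b β : Bid K M) :
    utility c b β =
      ∑ k : Fin K, if (k : ℕ) < alloc b β then (price b β : ℝ) / M - c k else 0 := by
  rw [utility, Finset.sum_filter]

theorem enc_mul_incrementWeights_inl (c : Fin K → ℝ) (b β : Bid K M) (k : Fin K)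
    (q : Fin (M + 1)) :
    enc b (Sum.inl (k, q)) * incrementWeights c β (Sum.inl (k, q)) =
      enc b (Sum.inl (k, q)) * if (k : ℕ) < alloc b β then (q : ℝ) / M - c k else 0 := by
  by_cases h : b.at k = q
  · simp only [incrementWeights, lt_alloc_iff, h]
  · simp [enc, h]

theorem enc_mul_incrementWeights_inr (c : Fin K → ℝ) (b β : Bid K M) (k : Fin (K - 1))
    (q : Fin M) :
    enc b (Sum.inr (k, q)) * incrementWeights c β (Sum.inr (k, q)) =
      enc b (Sum.inr (k, q)) * if (q : ℕ) + 1 ≤ price b β then ((k : ℝ) + 1) / M else 0 := by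
  by_cases h : b.at (lo k) ≤ q ∧ (q : ℕ) + 1 ≤ b.at (hi k)
  · simp only [incrementWeights, succ_le_at_rev_hi_iff h.1 h.2]
  · simp only [enc, if_neg h, zero_mul]

theorem sum_sub_eq_sum_mul_sub (a : ℕ → ℝ) (n : ℕ) :
    ∑ k ∈ Finset.range (n + 1), (a n - a k) =
      ∑ j ∈ Finset.range n, ((j : ℝ) + 1) * (a (j + 1) - a j) := by
  induction n with
  | zero => simp
  | succ n ih =>
    rw [Finset.sum_range_succ _ n, ← ih, Finset.sum_range_succ _ (n + 1), sub_self, add_zero]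
    simp only [Finset.sum_sub_distrib, Finset.sum_const, Finset.card_range, nsmul_eq_mul]
    push_cast
    ring

theorem sum_transitions (b : Bid K M) (k : Fin (K - 1)) (p : ℕ) (r : ℝ) :
    ∑ q : Fin M, enc b (Sum.inr (k, q)) * (if (q : ℕ) + 1 ≤ p then r else 0) =
      r * ((min (b.at (hi k)) p : ℕ) - (min (b.at (lo k)) p : ℕ)) := by
  have hlh : b.at (lo k) ≤ b.at (hi k) := b.at_mono (by rw [Fin.le_def, lo_val, hi_val]; omega)
  have hM := b.at_le (hi k)
  have e : ∀ q : Fin M, enc b (Sum.inr (k, q)) * (if (q : ℕ) + 1 ≤ p then r else 0) =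
      (fun q : ℕ => if q ∈ Finset.Ico (min (b.at (lo k)) p) (min (b.at (hi k)) p)
        then r else 0) (q : ℕ) := by
    intro q
    simp only [enc, Finset.mem_Ico]
    by_cases h1 : b.at (lo k) ≤ q ∧ (q : ℕ) + 1 ≤ b.at (hi k) <;>
      by_cases h2 : (q : ℕ) + 1 ≤ p
    · rw [if_pos h1, if_pos h2, if_pos (by omega), one_mul]
    · rw [if_pos h1, if_neg h2, mul_zero, if_neg (by omega)]
    · rw [if_neg h1, zero_mul, if_neg (by omega)]
    · rw [if_neg h1, zero_mul, if_neg (by omega)]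
  rw [Finset.sum_congr rfl fun q _ => e q, Fin.sum_univ_eq_sum_range
    (fun q : ℕ => if q ∈ Finset.Ico (min (b.at (lo k)) p) (min (b.at (hi k)) p) then r else 0) M,
    ← Finset.sum_filter]
  have hs : (Finset.range M).filter
      (fun q => q ∈ Finset.Ico (min (b.at (lo k)) p) (min (b.at (hi k)) p)) =
      Finset.Ico (min (b.at (lo k)) p) (min (b.at (hi k)) p) := by
    ext q
    simp only [Finset.mem_filter, Finset.mem_range, Finset.mem_Ico]
    omega
  rw [hs, Finset.sum_const, Nat.card_Ico, nsmul_eq_mul, Nat.cast_sub (by omega), mul_comm]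

/-- Abel summation of the bids truncated at the price: a grid step crossed between units `k + 1` and
`k + 2` raises the price of the first `k + 1` units. Unsold units contribute nothing, since their
bids are at least the price. -/
theorem sum_price_sub_bid (b β : Bid K M) :
    ∑ k : Fin K, ((price b β : ℝ) - (min (b.at k) (price b β) : ℕ)) =
      ∑ k : Fin (K - 1), ((k : ℝ) + 1) *
        ((min (b.at (hi k)) (price b β) : ℕ) - (min (b.at (lo k)) (price b β) : ℕ)) := by
  rcases K with _ | n
  · simp
  · set p := price b β with hp
    let a : ℕ → ℝ := fun k => if h : k < n + 1 then ((min (b.at ⟨k, h⟩) p : ℕ) : ℝ) else 0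
    -- The highest own bid is at least the price; otherwise all `K` own bids would lie strictly
    -- below it.
    have hlast : a n = p := by
      have h : p ≤ b.at ⟨n, n.lt_succ_self⟩ := by
        have h2 := countLT_price_lt n.succ_pos b β
        have a4 := lt_countLT_iff b (price b β) ⟨n, n.lt_succ_self⟩
        simp only at a4
        omega
      simp only [a, n.lt_succ_self, dite_true, min_eq_right h]
    have hl : ∑ k : Fin (n + 1), ((p : ℝ) - (min (b.at k) p : ℕ)) =
        ∑ k ∈ Finset.range (n + 1), (a n - a k) := by
      rw [← Fin.sum_univ_eq_sum_range (fun k => a n - a k)]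
      refine Finset.sum_congr rfl fun k _ => ?_
      simp only [hlast, a, k.2, dite_true]
    rw [hl, sum_sub_eq_sum_mul_sub,
      ← Fin.sum_univ_eq_sum_range (fun j => ((j : ℝ) + 1) * (a (j + 1) - a j))]
    refine Finset.sum_congr rfl fun k _ => ?_
    have hk : (k : ℕ) < n := k.2
    have h1 : (k : ℕ) < n + 1 := by omega
    have h2 : (k : ℕ) + 1 < n + 1 := by omega
    simp only [a, h1, h2, dite_true]
    rfl

theorem utility_eq_incrementWeights (c : Fin K → ℝ) (b β : Bid K M) :
    utility c b β = ∑ i, enc b i * incrementWeights c β i := by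
  rw [sum_coord]
  have e1 : ∀ k : Fin K, ∑ q, enc b (Sum.inl (k, q)) * incrementWeights c β (Sum.inl (k, q)) =
      if (k : ℕ) < alloc b β then (b.at k : ℝ) / M - c k else 0 := by
    intro k
    rw [← sum_enc_inl_mul b k fun q => if (k : ℕ) < alloc b β then (q : ℝ) / M - c k else 0]
    exact Finset.sum_congr rfl fun q _ => enc_mul_incrementWeights_inl c b β k q
  have e2 : ∀ k : Fin (K - 1),
      ∑ q, enc b (Sum.inr (k, q)) * incrementWeights c β (Sum.inr (k, q)) =
      (((k : ℝ) + 1) * ((min (b.at (hi k)) (price b β) : ℕ) -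
        (min (b.at (lo k)) (price b β) : ℕ))) / M := by
    intro k
    rw [Finset.sum_congr rfl fun q _ => enc_mul_incrementWeights_inr c b β k q, sum_transitions]
    ring
  rw [Finset.sum_congr rfl fun k _ => e1 k, Finset.sum_congr rfl fun k _ => e2 k,
    ← Finset.sum_div, ← sum_price_sub_bid, Finset.sum_div, ← Finset.sum_add_distrib,
    utility_eq_sum_ite]
  refine Finset.sum_congr rfl fun k _ => ?_
  by_cases h : (k : ℕ) < alloc b β
  · rw [if_pos h, if_pos h, min_eq_left (at_le_price_of_lt_alloc h)]
    ring
  · rw [if_neg h, if_neg h, min_eq_right (price_le_at_of_alloc_le (not_lt.mp h))]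
    simp

theorem abs_sub_le_one {x y : ℝ} (hx : x ∈ Set.Icc (0 : ℝ) 1) (hy : y ∈ Set.Icc (0 : ℝ) 1) :
    |x - y| ≤ 1 := by
  rw [abs_le]
  constructor <;> linarith [hx.1, hx.2, hy.1, hy.2]

theorem div_mem_Icc {q M : ℕ} (h : q ≤ M) : (q : ℝ) / M ∈ Set.Icc (0 : ℝ) 1 :=
  ⟨by positivity, div_le_one_of_le₀ (by exact_mod_cast h) (by positivity)⟩

theorem isWeightMap_incrementWeights {c : Fin K → ℝ} (hc : ∀ k, c k ∈ Set.Icc (0 : ℝ) 1) :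
    IsWeightMap (M := M) c (incrementWeights c) := by
  refine ⟨utility_eq_incrementWeights c, ?_⟩
  rintro β (⟨k, q⟩ | ⟨k, q⟩)
  · have h1 : (1 : ℝ) ≤ K := by exact_mod_cast (Nat.succ_le_of_lt (Nat.zero_lt_of_lt k.2))
    simp only [incrementWeights]
    split_ifs
    · exact (abs_sub_le_one (div_mem_Icc (Nat.lt_succ_iff.mp q.2)) (hc k)).trans h1
    · simp
  · simp only [incrementWeights]
    split_ifs
    · have h1 : ((k : ℝ) + 1) ≤ K := by
        have := k.2
        exact_mod_cast (by omega : (k : ℕ) + 1 ≤ K)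
      have h2 : (1 : ℝ) ≤ M := by exact_mod_cast (Nat.succ_le_of_lt (Nat.zero_lt_of_lt q.2))
      rw [abs_of_nonneg (by positivity)]
      exact (div_le_self (by positivity) h2).trans h1
    · simp

/-- The semi-bandit outcomes of the increment weights, recovered from the bid, the price and the
allocation. -/
noncomputable def recoverIncrements (c : Fin K → ℝ) (b : Bid K M) (p x : ℕ) : Coord K M → ℝ
  | Sum.inl (k, q) =>
      enc b (Sum.inl (k, q)) * if (k : ℕ) < x then (q : ℝ) / M - c k else 0
  | Sum.inr (k, q) =>
      enc b (Sum.inr (k, q)) * if (q : ℕ) + 1 ≤ p then ((k : ℝ) + 1) / M else 0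

theorem recoverIncrements_eq (c : Fin K → ℝ) (b β : Bid K M) :
    recoverIncrements c b (price b β) (alloc b β) = outcome (incrementWeights c) b β := by
  funext i
  rcases i with ⟨k, q⟩ | ⟨k, q⟩
  · simp only [recoverIncrements, outcome, enc_mul_incrementWeights_inl]
  · simp only [recoverIncrements, outcome, enc_mul_incrementWeights_inr]

/-! ### Event weights -/

/-- The equality `countLT β p + alloc = K` says that the demand is exhausted, which singles out the
case of a price set by the principal. At the level of the bid itself the event becomes `countLT β
(b.at k) + (k + 1) = K`, also when `k + 1 = K` and the lower bound on the price is void. -/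
theorem eventWeights_inl_iff (b β : Bid K M) (k : Fin K) :
    ((∀ k' : Fin K, (k' : ℕ) = k + 1 → β.at k'.rev < b.at k) ∧ b.at k ≤ β.at k.rev) ↔
      (k : ℕ) + 1 = alloc b β ∧ countLT β (price b β) + alloc b β = K := by
  have hk := k.2
  have hE : ((∀ k' : Fin K, (k' : ℕ) = k + 1 → β.at k'.rev < b.at k) ∧
      b.at k ≤ β.at k.rev) ↔ countLT β (b.at k) + (k + 1) = K := by
    rw [le_at_rev_iff]
    constructor
    · rintro ⟨h1, h2⟩
      by_cases hk1 : (k : ℕ) + 1 < K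
      · have := h1 ⟨k + 1, hk1⟩ rfl
        have h3 := le_at_rev_iff β ⟨k + 1, hk1⟩ (b.at k)
        simp only at h3
        omega
      · omega
    · intro h
      refine ⟨fun k' hk' => ?_, h.le⟩
      have h3 := le_at_rev_iff β k' (b.at k)
      omega
  rw [hE]
  have e1 := le_countLE_price b β
  have e2 := countLT_price_lt (by omega) b β
  constructor
  · intro h
    have a1 := lt_countLE_iff b (b.at k) k
    have a2 := lt_countLT_iff b (b.at k) k
    have a4 := lt_at_rev_iff β k (b.at k)
    have a5 : K - (k + 1) ≤ countLE β (b.at k) := by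
      by_cases hk1 : (k : ℕ) + 1 < K
      · have h3 := le_at_rev_iff β ⟨k + 1, hk1⟩ (b.at k)
        have h4 := lt_at_rev_iff β ⟨k + 1, hk1⟩ (b.at k)
        simp only at h3 h4
        omega
      · omega
    have hp : price b β = b.at k := price_eq (by omega) (by omega)
    have hx : alloc b β = k + 1 := by
      rw [alloc_eq, hp]
      omega
    rw [hx, hp]
    exact ⟨rfl, h⟩
  · rintro ⟨h1, h2⟩
    have hp : b.at k = price b β := by
      refine le_antisymm (at_le_price_of_lt_alloc (by omega)) ?_
      have a4 := lt_countLT_iff b (price b β) k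
      omega
    rw [hp, h1]
    exact h2

theorem eventWeights_inr_iff (b β : Bid K M) (k : Fin (K - 1)) (q : ℕ) :
    ((b.at (lo k) ≤ q ∧ q + 1 ≤ b.at (hi k)) ∧ β.at (hi k).rev = q) ↔
      q = price b β ∧ (k : ℕ) + 1 = alloc b β ∧
        countLT β (price b β) + alloc b β < K := by
  have hk := k.2
  have e1 := le_countLE_price b β
  have e2 := countLT_price_lt (by omega) b β
  constructor
  · rintro ⟨⟨h1, h2⟩, h3⟩
    have a1 := lt_countLE_iff b q (lo k)
    have a2 := lt_countLE_iff b q (hi k)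
    have a2' := lt_countLT_iff b q (hi k)
    have a3 := le_at_rev_iff β (hi k) q
    have a4 := lt_at_rev_iff β (hi k) q
    rw [hi_val] at *
    rw [lo_val] at *
    have hp : price b β = q := price_eq (by omega) (by omega)
    have hx : alloc b β = k + 1 := by
      rw [alloc_eq, hp]
      omega
    rw [hx, hp]
    exact ⟨rfl, rfl, by omega⟩
  · rintro ⟨rfl, h1, h2⟩
    have a1 := lt_countLE_iff b (price b β) (lo k)
    have a2 := lt_countLE_iff b (price b β) (hi k)
    have a3 := le_at_rev_iff β (hi k) (price b β)
    have a4 := lt_at_rev_iff β (hi k) (price b β)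
    have hx := alloc_eq b β
    rw [hi_val] at *
    rw [lo_val] at *
    omega

theorem utility_eq_payoff {c : Fin K → ℝ} {b β : Bid K M} {k : ℕ} (h : k + 1 = alloc b β) :
    utility c b β = payoff M c k (price b β) := by
  rw [utility, payoff, ← h]
  simp only [Nat.lt_succ_iff]

theorem enc_mul_eventWeights_inr (c : Fin K → ℝ) (b β : Bid K M) (k : Fin (K - 1)) (q : Fin M) :
    enc b (Sum.inr (k, q)) * eventWeights c β (Sum.inr (k, q)) =
      if (q : ℕ) = price b β ∧ (k : ℕ) + 1 = alloc b β ∧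
        countLT β (price b β) + alloc b β < K then utility c b β else 0 := by
  have h := eventWeights_inr_iff b β k q
  by_cases hc : (q : ℕ) = price b β ∧ (k : ℕ) + 1 = alloc b β ∧
      countLT β (price b β) + alloc b β < K
  · obtain ⟨h1, h2⟩ := h.mpr hc
    simp only [enc, eventWeights]
    rw [if_pos h1, if_pos h2, if_pos hc, one_mul, utility_eq_payoff hc.2.1, hc.1]
  · rw [if_neg hc]
    simp only [enc, eventWeights]
    by_cases h1 : b.at (lo k) ≤ q ∧ (q : ℕ) + 1 ≤ b.at (hi k)
    · rw [if_neg (fun h2 => hc (h.mp ⟨h1, h2⟩)), mul_zero]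
    · rw [if_neg h1, zero_mul]

theorem sum_enc_mul_eventWeights_inl (c : Fin K → ℝ) (b β : Bid K M) (k : Fin K) :
    ∑ q, enc b (Sum.inl (k, q)) * eventWeights c β (Sum.inl (k, q)) =
      if (k : ℕ) + 1 = alloc b β ∧ countLT β (price b β) + alloc b β = K
        then utility c b β else 0 := by
  classical
  have e := sum_enc_inl_mul b k fun q =>
    if (∀ k' : Fin K, (k' : ℕ) = k + 1 → β.at k'.rev < q) ∧ q ≤ β.at k.rev
      then payoff M c k q else 0
  have h0 : ∑ q, enc b (Sum.inl (k, q)) * eventWeights c β (Sum.inl (k, q)) =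
      if (∀ k' : Fin K, (k' : ℕ) = k + 1 → β.at k'.rev < b.at k) ∧ b.at k ≤ β.at k.rev
        then payoff M c k (b.at k) else 0 := by
    rw [← e]
    refine Finset.sum_congr rfl fun q _ => ?_
    simp only [eventWeights]
  rw [h0]
  simp only [eventWeights_inl_iff]
  split_ifs with hc
  · have hk := k.2
    have e2 := countLT_price_lt (by omega) b β
    have hp : b.at k = price b β := by
      refine le_antisymm (at_le_price_of_lt_alloc (by omega)) ?_
      have a4 := lt_countLT_iff b (price b β) k
      omega
    rw [utility_eq_payoff hc.1, hp]
  · rfl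

/-- With at least one unit sold, exactly one coordinate survives, according to whether `countLT β p
+ alloc` equals `K` or is smaller. -/
theorem utility_eq_eventWeights (c : Fin K → ℝ) (b β : Bid K M) :
    utility c b β = ∑ i, enc b i * eventWeights c β i := by
  rw [sum_coord, Finset.sum_congr rfl fun k _ => sum_enc_mul_eventWeights_inl c b β k,
    Finset.sum_congr rfl fun k _ => Finset.sum_congr rfl fun q _ =>
      enc_mul_eventWeights_inr c b β k q]
  have hxK : countLT β (price b β) + alloc b β ≤ K := by
    have := countLT_le β (price b β)
    have := alloc_eq b β
    omega
  rcases Nat.eq_zero_or_pos (alloc b β) with hx | hx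
  · have hu : utility c b β = 0 := by simp [utility, hx]
    simp [hu]
  obtain ⟨m, hm⟩ := Nat.exists_eq_succ_of_ne_zero hx.ne'
  rw [Nat.succ_eq_add_one] at hm
  have hmK : m < K := by omega
  by_cases hA : countLT β (price b β) + alloc b β = K
  · rw [Fintype.sum_eq_single ⟨m, hmK⟩, if_pos ⟨hm.symm, hA⟩,
      Finset.sum_eq_zero, add_zero]
    · intro k _
      refine Finset.sum_eq_zero fun q _ => if_neg ?_
      omega
    · intro k hk
      refine if_neg fun h => hk (Fin.ext ?_)
      simp only
      omega
  · have hm1 : m < K - 1 := by omega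
    -- The next own bid lies strictly above the price, so the price is a valid lower end of a grid
    -- transition.
    have hpM : price b β < M := by
      have a2 := lt_countLE_iff b (price b β) (hi ⟨m, hm1⟩)
      rw [hi_val] at a2
      have := alloc_eq b β
      have := b.at_le (hi ⟨m, hm1⟩)
      simp only at a2
      omega
    rw [Finset.sum_eq_zero (fun k _ => if_neg fun h => hA h.2), zero_add,
      Fintype.sum_eq_single ⟨m, hm1⟩, Fintype.sum_eq_single ⟨price b β, hpM⟩,
      if_pos ⟨rfl, hm.symm, by omega⟩]
    · intro q hq
      exact if_neg fun h => hq (Fin.ext h.1)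
    · intro k hk
      refine Finset.sum_eq_zero fun q _ => if_neg fun h => hk (Fin.ext ?_)
      simp only
      omega

theorem abs_payoff_le {c : Fin K → ℝ} (hc : ∀ k, c k ∈ Set.Icc (0 : ℝ) 1) (k : ℕ) {q : ℕ}
    (hq : q ≤ M) : |payoff M c k q| ≤ K := by
  refine (Finset.abs_sum_le_sum_abs _ _).trans ?_
  refine (Finset.sum_le_card_nsmul _ _ 1 fun l _ => abs_sub_le_one (div_mem_Icc hq) (hc l)).trans ?_
  rw [nsmul_eq_mul, mul_one]
  exact_mod_cast (Finset.card_le_univ _).trans_eq (Fintype.card_fin K)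

theorem isWeightMap_eventWeights {c : Fin K → ℝ} (hc : ∀ k, c k ∈ Set.Icc (0 : ℝ) 1) :
    IsWeightMap (M := M) c (eventWeights c) := by
  refine ⟨utility_eq_eventWeights c, ?_⟩
  rintro β (⟨k, q⟩ | ⟨k, q⟩)
  · simp only [eventWeights]
    split_ifs
    · exact abs_payoff_le hc _ (Nat.lt_succ_iff.mp q.2)
    · simp
  · simp only [eventWeights]
    split_ifs
    · exact abs_payoff_le hc _ q.2.le
    · simp

/-! ### The regularizer in one coordinate -/

/-- One summand of the hybrid regularizer. -/
noncomputable def psi (γ x : ℝ) : ℝ := -√x + γ * ((1 - x) * Real.log (1 - x))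

/-- The derivative of `psi γ` on `(0, 1)`. -/
noncomputable def psiDeriv (γ x : ℝ) : ℝ := -(1 / (2 * √x)) + γ * (-Real.log (1 - x) - 1)

/-- The Bregman divergence of `psi γ`. -/
noncomputable def breg (γ y x : ℝ) : ℝ := psi γ y - psi γ x - psiDeriv γ x * (y - x)

theorem regularizer_eq_sum_psi (γ : ℝ) (x : Coord K M → ℝ) :
    regularizer γ x = ∑ i, psi γ (x i) := rfl

theorem hasDerivAt_psi (γ : ℝ) {x : ℝ} (h0 : 0 < x) (h1 : x < 1) :
    HasDerivAt (psi γ) (psiDeriv γ x) x := by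
  have e1 : HasDerivAt (fun x : ℝ => √x) (1 / (2 * √x)) x := Real.hasDerivAt_sqrt h0.ne'
  have e2 : HasDerivAt (fun x : ℝ => 1 - x) (-1) x := by
    simpa using (hasDerivAt_id x).const_sub 1
  have e3 : HasDerivAt (fun x : ℝ => (1 - x) * Real.log (1 - x))
      ((Real.log (1 - x) + 1) * -1) x :=
    (Real.hasDerivAt_mul_log (sub_pos.mpr h1).ne').comp x e2
  refine (e1.neg.add (e3.const_mul γ)).congr_deriv ?_
  simp only [psiDeriv]
  ring

theorem convexOn_psi {γ : ℝ} (hγ : 0 ≤ γ) : ConvexOn ℝ (Set.Icc 0 1) (psi γ) := by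
  have h1 : ConvexOn ℝ (Set.Icc (0 : ℝ) 1) fun x => -√x :=
    (Real.strictConcaveOn_sqrt.concaveOn.neg).subset (fun x hx => hx.1) (convex_Icc 0 1)
  have h2 : ConvexOn ℝ (Set.Icc (0 : ℝ) 1) fun x => (1 - x) * Real.log (1 - x) := by
    refine ⟨convex_Icc 0 1, fun x hx y hy a b ha hb hab => ?_⟩
    have := Real.convexOn_mul_log.2 (x := 1 - x) (y := 1 - y) (Set.mem_Ici.mpr (sub_nonneg.mpr hx.2))
      (Set.mem_Ici.mpr (sub_nonneg.mpr hy.2)) ha hb hab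
    simp only [smul_eq_mul] at this ⊢
    have e : 1 - (a * x + b * y) = a * (1 - x) + b * (1 - y) := by
      linear_combination -hab
    rw [e]
    exact this
  exact h1.add (h2.smul hγ)

/-- Fenchel-Young inequality for the relative entropy. -/
theorem mul_le_klTerm {u v : ℝ} (hu : 0 < u) (hv : 0 ≤ v) (s : ℝ) :
    v * s ≤ v * Real.log v - v * Real.log u - v + u * Real.exp s := by
  rcases hv.eq_or_lt with rfl | hv
  · simp only [zero_mul, sub_zero, zero_add]
    positivity
  · have h := Real.log_le_sub_one_of_pos (x := u * Real.exp s / v) (by positivity)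
    rw [Real.log_div (by positivity) hv.ne', Real.log_mul hu.ne' (Real.exp_ne_zero _),
      Real.log_exp] at h
    have h2 := mul_le_mul_of_nonneg_left h hv.le
    have e : v * (u * Real.exp s / v - 1) = u * Real.exp s - v := by field_simp
    rw [e] at h2
    linarith

/-- The divergence splits into a weighted squared distance of square roots and a relative entropy of
`1 - y` against `1 - x`. Both parts are nonnegative, so either may be dropped. -/
theorem breg_eq (γ : ℝ) {x y : ℝ} (hx : 0 < x) (hy : 0 ≤ y) :
    breg γ y x = (√y - √x) ^ 2 / (2 * √x) +
      γ * ((1 - y) * Real.log (1 - y) - (1 - y) * Real.log (1 - x) - (1 - y) + (1 - x)) := by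
  have hs : 0 < √x := Real.sqrt_pos.mpr hx
  have e : (√y - √x) ^ 2 / (2 * √x) = -√y + √x + 1 / (2 * √x) * (y - x) := by
    have hx2 := Real.sq_sqrt hx.le
    have hy2 := Real.sq_sqrt hy
    field_simp
    linear_combination hy2 - hx2
  rw [e]
  simp only [breg, psi, psiDeriv]
  ring

theorem sq_le_breg {γ : ℝ} (hγ : 0 ≤ γ) {x y : ℝ} (hx0 : 0 < x) (hx1 : x < 1) (hy0 : 0 ≤ y)
    (hy1 : y ≤ 1) : (√y - √x) ^ 2 / (2 * √x) ≤ breg γ y x := by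
  rw [breg_eq γ hx0 hy0]
  have h := mul_le_klTerm (sub_pos.mpr hx1) (sub_nonneg.mpr hy1) 0
  rw [mul_zero, Real.exp_zero, mul_one] at h
  linarith [mul_nonneg hγ h]

theorem klTerm_le_breg (γ : ℝ) {x y : ℝ} (hx0 : 0 < x) (hy0 : 0 ≤ y) :
    γ * ((1 - y) * Real.log (1 - y) - (1 - y) * Real.log (1 - x) - (1 - y) + (1 - x)) ≤
      breg γ y x := by
  rw [breg_eq γ hx0 hy0]
  have : 0 ≤ (√y - √x) ^ 2 / (2 * √x) := by positivity
  linarith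

theorem breg_nonneg {γ : ℝ} (hγ : 0 ≤ γ) {x y : ℝ} (hx0 : 0 < x) (hx1 : x < 1) (hy0 : 0 ≤ y)
    (hy1 : y ≤ 1) : 0 ≤ breg γ y x :=
  le_trans (by positivity) (sq_le_breg hγ hx0 hx1 hy0 hy1)

/-! ### Stability in one coordinate -/

theorem mul_sub_div_sq_le {a b d : ℝ} (hb : 0 < b) : a * d - d ^ 2 / b ≤ b * a ^ 2 / 4 := by
  have h : b * a ^ 2 / 4 - (a * d - d ^ 2 / b) = (d - a * b / 2) ^ 2 / b := by
    field_simp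
    ring
  have : 0 ≤ (d - a * b / 2) ^ 2 / b := by positivity
  linarith

/-- On `[0, 1]` the squared distance of points is at most four times that of their square roots, so
the divergence dominates a quadratic in `x - y`, and completing the square finishes. -/
theorem stability_sqrt {γ : ℝ} (hγ : 0 ≤ γ) {x y r : ℝ} (hr : 0 < r) (hx0 : 0 < x) (hx1 : x < 1)
    (hy0 : 0 ≤ y) (hy1 : y ≤ 1) (l : ℝ) :
    (x - y) * l - r * breg γ y x ≤ 2 * √x * l ^ 2 / r := by
  have hs : 0 < √x := Real.sqrt_pos.mpr hx0
  have hb := mul_le_mul_of_nonneg_left (sq_le_breg hγ hx0 hx1 hy0 hy1) hr.le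
  have hsq : (x - y) ^ 2 ≤ 4 * (√y - √x) ^ 2 := by
    have hx2 := Real.sq_sqrt hx0.le
    have hy2 := Real.sq_sqrt hy0
    have e : (x - y) ^ 2 = (√y - √x) ^ 2 * (√x + √y) ^ 2 := by
      rw [← hx2, ← hy2, Real.sqrt_sq hs.le, Real.sqrt_sq (Real.sqrt_nonneg y)]
      ring
    have h1 : √x ≤ 1 := Real.sqrt_le_one.mpr hx1.le
    have h2 : √y ≤ 1 := Real.sqrt_le_one.mpr hy1
    have h3 : (√x + √y) ^ 2 ≤ 4 := by
      have h4 : √x + √y ≤ 2 := by linarith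
      have h5 : 0 ≤ √x + √y := by positivity
      nlinarith
    rw [e]
    nlinarith [sq_nonneg (√y - √x)]
  have h := mul_sub_div_sq_le (a := l) (b := 8 * √x / r) (d := x - y) (by positivity)
  have h2 : (x - y) ^ 2 / (8 * √x / r) ≤ r * ((√y - √x) ^ 2 / (2 * √x)) := by
    have e : r * ((√y - √x) ^ 2 / (2 * √x)) = 4 * (√y - √x) ^ 2 / (8 * √x / r) := by
      field_simp
      ring
    rw [e]
    gcongr
  have e : 8 * √x / r * l ^ 2 / 4 = 2 * √x * l ^ 2 / r := by ring
  linarith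

/-- For nonnegative losses `x - y ≤ 2 * √x * (√x - √y)` gains a factor `x` over `stability_sqrt`.
This is what makes losses of order `1 / x` affordable. -/
theorem stability_sqrt_of_nonneg {γ : ℝ} (hγ : 0 ≤ γ) {x y r : ℝ} (hr : 0 < r) (hx0 : 0 < x)
    (hx1 : x < 1) (hy0 : 0 ≤ y) (hy1 : y ≤ 1) {l : ℝ} (hl : 0 ≤ l) :
    (x - y) * l - r * breg γ y x ≤ 2 * (x * √x) * l ^ 2 / r := by
  have hs : 0 < √x := Real.sqrt_pos.mpr hx0
  have hb := mul_le_mul_of_nonneg_left (sq_le_breg hγ hx0 hx1 hy0 hy1) hr.le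
  have hx2 := Real.sq_sqrt hx0.le
  have hy2 := Real.sq_sqrt hy0
  have h1 : (x - y) * l ≤ (2 * √x * l) * (√x - √y) := by
    have : x - y ≤ 2 * √x * (√x - √y) := by nlinarith [sq_nonneg (√x - √y)]
    nlinarith
  have h := mul_sub_div_sq_le (a := 2 * √x * l) (b := 2 * √x / r) (d := √x - √y) (by positivity)
  have e1 : (√x - √y) ^ 2 / (2 * √x / r) = r * ((√y - √x) ^ 2 / (2 * √x)) := by
    field_simp
    ring
  have e2 : 2 * √x / r * (2 * √x * l) ^ 2 / 4 = 2 * (√x ^ 2 * √x) * l ^ 2 / r := by ring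
  rw [hx2] at e2
  linarith

theorem exp_sub_one_sub_le {s S : ℝ} (hS : 0 ≤ S) (h : s ≤ S) :
    Real.exp s - 1 - s ≤ s ^ 2 * Real.exp S := by
  have h1 : Real.exp s - 1 - s ≤ s * (Real.exp s - 1) := by
    have h2 := mul_le_mul_of_nonneg_left (Real.add_one_le_exp (-s)) (Real.exp_pos s).le
    rw [← Real.exp_add, add_neg_cancel, Real.exp_zero] at h2
    linarith
  refine h1.trans ?_
  rcases le_total 0 s with hs | hs
  · have h2 := mul_le_mul_of_nonneg_left (Real.add_one_le_exp (-s)) (Real.exp_pos s).le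
    rw [← Real.exp_add, add_neg_cancel, Real.exp_zero] at h2
    have h3 : Real.exp s ≤ Real.exp S := Real.exp_le_exp.mpr h
    nlinarith [mul_le_mul_of_nonneg_left h3 (sq_nonneg s)]
  · have h3 := Real.add_one_le_exp s
    have h4 : 1 ≤ Real.exp S := Real.one_le_exp hS
    nlinarith [mul_le_mul_of_nonneg_left h4 (sq_nonneg s)]

/-- Fenchel-Young with slope `s = l / (r * γ)` leaves `r * γ * (1 - x) * (exp s - 1 - s)`, which is
quadratic in `s` as soon as `s` is bounded above. -/
theorem stability_log {γ : ℝ} (hγ : 0 < γ) {x y r : ℝ} (hr : 0 < r) (hx0 : 0 < x) (hx1 : x < 1)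
    (hy0 : 0 ≤ y) (hy1 : y ≤ 1) {l S : ℝ} (hS : 0 ≤ S) (hl : l / (r * γ) ≤ S) :
    (x - y) * l - r * breg γ y x ≤ (1 - x) * (l ^ 2 * Real.exp S / γ) / r := by
  have hb := mul_le_mul_of_nonneg_left (klTerm_le_breg γ hx0 hy0 (x := x)) hr.le
  have hy := mul_le_klTerm (sub_pos.mpr hx1) (sub_nonneg.mpr hy1) (l / (r * γ))
  have he := mul_le_mul_of_nonneg_left (exp_sub_one_sub_le hS hl) (sub_pos.mpr hx1).le
  have e1 : (x - y) * l = r * γ * ((1 - y) * (l / (r * γ)) - (1 - x) * (l / (r * γ))) := by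
    field_simp
    ring
  have e2 : (1 - x) * (l ^ 2 * Real.exp S / γ) / r =
      r * γ * ((1 - x) * ((l / (r * γ)) ^ 2 * Real.exp S)) := by
    field_simp
  have hrγ : 0 < r * γ := mul_pos hr hγ
  rw [e1, e2]
  nlinarith [mul_le_mul_of_nonneg_left hy hrγ.le, mul_le_mul_of_nonneg_left he hrγ.le]

/-- Constant of the stability term coming from the logarithmic part of the regularizer. -/
noncomputable def logConst (κ γ : ℝ) : ℝ := 16 * κ ^ 2 * Real.exp (4 * κ / γ) / γ

/-- Stability bound of a coordinate which is not played. -/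
noncomputable def stabBase (κ γ x : ℝ) : ℝ :=
  if x < 1 / 2 then 2 * κ ^ 2 * √x else logConst κ γ * (1 - x)

/-- Increase of the stability bound of a coordinate when it is played. -/
noncomputable def stabPlayed (κ x : ℝ) : ℝ := if x < 1 / 2 then 8 * κ ^ 2 / √x else 0

theorem logConst_nonneg (κ : ℝ) {γ : ℝ} (hγ : 0 < γ) : 0 ≤ logConst κ γ := by
  unfold logConst
  positivity

/-- Below `1 / 2`, a nonpositive loss has size at most `κ` and a positive one occurs only if the
coordinate is played; the square root handles both. From `1 / 2` on, the loss is bounded by `4 * κ`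
and the entropy applies. -/
theorem stability_coord {γ κ x y r w h : ℝ} (hγ : 0 < γ) (hr : 1 ≤ r) (hx0 : 0 < x) (hx1 : x < 1)
    (hy0 : 0 ≤ y) (hy1 : y ≤ 1) (hw : |w| ≤ κ) (hh : h = 0 ∨ h = 1) :
    (x - y) * ((-(h * w) + κ) * h / x - κ) - r * breg γ y x ≤
      (stabBase κ γ x + stabPlayed κ x * h) / r := by
  have hr0 : 0 < r := by linarith
  have hκ : 0 ≤ κ := (abs_nonneg w).trans hw
  have hw' := abs_le.mp hw
  have hs : 0 < √x := Real.sqrt_pos.mpr hx0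
  set l := (-(h * w) + κ) * h / x - κ with hl
  -- The shift by `κ` in the estimate makes the importance-weighted part nonnegative.
  have hlow : -κ ≤ l := by
    have : 0 ≤ (-(h * w) + κ) * h / x := by
      rcases hh with rfl | rfl
      · simp
      · have : 0 ≤ -(1 * w) + κ := by linarith
        positivity
    linarith
  have hup : l ≤ 2 * κ * h / x := by
    have : (-(h * w) + κ) * h / x ≤ 2 * κ * h / x := by
      rcases hh with rfl | rfl
      · simp
      · gcongr
        linarith
    linarith
  by_cases hx : x < 1 / 2
  · simp only [stabBase, stabPlayed, if_pos hx]
    have hp : 0 ≤ 8 * κ ^ 2 / √x * h := by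
      rcases hh with rfl | rfl <;> positivity
    rcases le_total l 0 with hl0 | hl0
    · refine (stability_sqrt hγ.le hr0 hx0 hx1 hy0 hy1 l).trans ?_
      have : l ^ 2 ≤ κ ^ 2 := sq_le_sq' hlow (by linarith)
      gcongr
      nlinarith
    · rcases hh with rfl | rfl
      · have : l = 0 := le_antisymm (by simpa using hup) hl0
        rw [this]
        have := mul_nonneg hr0.le (breg_nonneg hγ.le hx0 hx1 hy0 hy1)
        have : 0 ≤ (2 * κ ^ 2 * √x + 8 * κ ^ 2 / √x * 0) / r := by positivity
        linarith
      · refine (stability_sqrt_of_nonneg hγ.le hr0 hx0 hx1 hy0 hy1 hl0).trans ?_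
        gcongr
        have h1 : l ^ 2 ≤ (2 * κ * 1 / x) ^ 2 := by gcongr
        have h2 : 2 * (x * √x) * l ^ 2 ≤ 2 * (x * √x) * (2 * κ * 1 / x) ^ 2 := by gcongr
        have e : 2 * (x * √x) * (2 * κ * 1 / x) ^ 2 = 8 * κ ^ 2 / √x * 1 := by
          have hx2 := Real.sq_sqrt hx0.le
          field_simp
          linear_combination 8 * κ ^ 2 * hx2
        have : 0 ≤ 2 * κ ^ 2 * √x := by positivity
        linarith
  · simp only [stabBase, stabPlayed, if_neg hx, zero_mul, add_zero]
    have hup2 : l ≤ 4 * κ := by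
      refine hup.trans ?_
      rw [div_le_iff₀ hx0]
      rcases hh with rfl | rfl <;> nlinarith
    -- Here `1 ≤ r` makes the exponent independent of the round.
    have hS : l / (r * γ) ≤ 4 * κ / γ := by
      rw [div_le_div_iff₀ (by positivity) hγ]
      have : l ≤ 4 * κ * r := by nlinarith
      nlinarith
    refine (stability_log hγ hr0 hx0 hx1 hy0 hy1 (by positivity) hS).trans ?_
    have h1 : l ^ 2 ≤ 16 * κ ^ 2 := by nlinarith
    have h2 : 0 ≤ 1 - x := by linarith
    unfold logConst
    rw [mul_comm (16 * κ ^ 2 * Real.exp (4 * κ / γ) / γ)]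
    gcongr

theorem sqrt_le_sqrt_abs_sub {x u : ℝ} (hx0 : 0 ≤ x) (hx : x ≤ 1 / 2) (hu : u = 0 ∨ u = 1) :
    √x ≤ √|x - u| := by
  refine Real.sqrt_le_sqrt ?_
  rcases hu with rfl | rfl
  · rw [sub_zero, abs_of_nonneg hx0]
  · rw [abs_of_nonpos (by linarith)]
    linarith

theorem le_sqrt_self {x : ℝ} (h0 : 0 ≤ x) (h1 : x ≤ 1) : x ≤ √x := by
  rw [Real.le_sqrt h0 h0]
  nlinarith

theorem one_sub_le_sqrt_abs_sub {x u : ℝ} (hx1 : x ≤ 1) (hx : 1 / 2 ≤ x) (hu : u = 0 ∨ u = 1) :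
    1 - x ≤ √|x - u| := by
  refine (le_sqrt_self (by linarith) (by linarith)).trans (Real.sqrt_le_sqrt ?_)
  rcases hu with rfl | rfl
  · rw [sub_zero, abs_of_nonneg (by linarith)]
    linarith
  · rw [abs_of_nonpos (by linarith)]
    linarith

/-- A coordinate is played with probability `x`, which turns the increase `8 * κ ^ 2 / √x` into `8 *
κ ^ 2 * √x`. The resulting bound vanishes at both ends of `[0, 1]`, hence is controlled by the
distance to either vertex value. -/
theorem stab_mean_le {γ : ℝ} (hγ : 0 < γ) (κ : ℝ) {x u : ℝ} (hx0 : 0 < x) (hx1 : x < 1)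
    (hu : u = 0 ∨ u = 1) :
    stabBase κ γ x + stabPlayed κ x * x ≤ (10 * κ ^ 2 + logConst κ γ) * √|x - u| := by
  have hL := logConst_nonneg κ hγ
  have hs : 0 < √x := Real.sqrt_pos.mpr hx0
  have hq : 0 ≤ √|x - u| := Real.sqrt_nonneg _
  by_cases hx : x < 1 / 2
  · simp only [stabBase, stabPlayed, if_pos hx]
    have e : 8 * κ ^ 2 / √x * x = 8 * κ ^ 2 * √x := by
      have hx2 := Real.sq_sqrt hx0.le
      field_simp
      linear_combination -κ ^ 2 * hx2
    rw [e]
    nlinarith [mul_le_mul_of_nonneg_left (sqrt_le_sqrt_abs_sub hx0.le hx.le hu) (sq_nonneg κ),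
      mul_nonneg hL hq]
  · simp only [stabBase, stabPlayed, if_neg hx, zero_mul, add_zero]
    nlinarith [mul_le_mul_of_nonneg_left (one_sub_le_sqrt_abs_sub hx1.le (not_lt.mp hx) hu) hL,
      mul_nonneg (sq_nonneg κ) hq]

/-! ### The penalty in one coordinate -/

theorem neg_mul_log_le {v : ℝ} (hv : 0 ≤ v) : -(v * Real.log v) ≤ 1 - v := by
  have h := mul_le_klTerm one_pos hv 0
  simp only [Real.log_one, mul_zero, Real.exp_zero] at h
  linarith

theorem neg_mul_log_le_sqrt {v : ℝ} (hv : 0 ≤ v) : -(v * Real.log v) ≤ 2 * √v := by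
  rcases hv.eq_or_lt with rfl | hv
  · simp
  · have hs : 0 < √v := Real.sqrt_pos.mpr hv
    have h := neg_mul_log_le hs.le
    -- Applying the linear bound to `√v` instead of `v` trades the logarithm for a square root.
    have e : v * Real.log v = 2 * √v * (√v * Real.log √v) := by
      rw [Real.log_sqrt hv.le]
      have := Real.sq_sqrt hv.le
      linear_combination -(Real.log v) * this
    rw [e]
    nlinarith

theorem psi_sub_psi_le {γ : ℝ} (hγ1 : γ ≤ 1) {x u : ℝ} (hx0 : 0 ≤ x) (hx1 : x ≤ 1)
    (hu : u = 0 ∨ u = 1) : psi γ u - psi γ x ≤ 2 * √|x - u| := by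
  have hv : 0 ≤ 1 - x := by linarith
  have hlog : 0 ≤ -((1 - x) * Real.log (1 - x)) := by
    have := Real.log_nonpos hv (by linarith)
    nlinarith
  have hγlog : γ * -((1 - x) * Real.log (1 - x)) ≤ -((1 - x) * Real.log (1 - x)) := by nlinarith
  rcases hu with rfl | rfl
  · have h1 := neg_mul_log_le hv
    have h2 := le_sqrt_self hx0 hx1
    rw [sub_zero, abs_of_nonneg hx0]
    simp only [psi, Real.sqrt_zero, sub_zero, Real.log_one, mul_zero, neg_zero, add_zero]
    linarith
  · have h1 := neg_mul_log_le_sqrt hv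
    have h2 : √x ≤ 1 := Real.sqrt_le_one.mpr hx1
    rw [abs_of_nonpos (by linarith), neg_sub]
    simp only [psi, Real.sqrt_one, sub_self, zero_mul, mul_zero, add_zero]
    linarith

/-! ### The polytope -/

theorem enc_eq_zero_or_one (b : Bid K M) (i : Coord K M) : enc b i = 0 ∨ enc b i = 1 := by
  rcases i with ⟨k, q⟩ | ⟨k, q⟩ <;> simp only [enc] <;> split_ifs <;> simp

theorem enc_mul_self (b : Bid K M) (i : Coord K M) : enc b i * enc b i = enc b i := by
  rcases enc_eq_zero_or_one b i with h | h <;> simp [h]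

theorem enc_mem_convH (b : Bid K M) : enc b ∈ convH K M := subset_convexHull ℝ _ ⟨b, rfl⟩

theorem convex_convH : Convex ℝ (convH K M) := convex_convexHull ℝ _

theorem mem_Icc_of_mem_convH {x : Coord K M → ℝ} (hx : x ∈ convH K M) (i : Coord K M) :
    x i ∈ Set.Icc (0 : ℝ) 1 := by
  have h : convH K M ⊆ Set.Icc (0 : Coord K M → ℝ) 1 := by
    refine convexHull_min ?_ (convex_Icc _ _)
    rintro _ ⟨b, rfl⟩
    constructor <;> intro i <;> rcases enc_eq_zero_or_one b i with h | h <;> simp [h]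
  exact ⟨(h hx).1 i, (h hx).2 i⟩

theorem exists_enc_eq_one (i : Coord K M) : ∃ b : Bid K M, enc b i = 1 := by
  rcases i with ⟨k, q⟩ | ⟨k, q⟩
  · refine ⟨⟨fun _ => q, fun _ _ _ => le_rfl⟩, ?_⟩
    simp [enc, Bid.at]
  · refine ⟨⟨fun j => if j ≤ lo k then q.castSucc else q.succ, fun i j hij => ?_⟩, ?_⟩
    · simp only
      split_ifs with h1 h2
      · exact le_rfl
      · exact (Fin.castSucc_lt_succ).le
      · exact absurd (hij.trans ‹_›) h1
      · exact le_rfl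
    · have h : ¬ hi k ≤ lo k := by
        rw [Fin.le_def, hi_val, lo_val]
        omega
      simp [enc, Bid.at, h]

theorem exists_enc_eq_zero (hM : 0 < M) (i : Coord K M) : ∃ b : Bid K M, enc b i = 0 := by
  rcases i with ⟨k, q⟩ | ⟨k, q⟩
  · by_cases hq : q = 0
    · refine ⟨⟨fun _ => Fin.last M, fun _ _ _ => le_rfl⟩, ?_⟩
      simp [enc, Bid.at, hq, hM.ne']
    · refine ⟨⟨fun _ => 0, fun _ _ _ => le_rfl⟩, ?_⟩
      have : (0 : ℕ) ≠ q := fun h => hq (Fin.ext h.symm)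
      simp [enc, Bid.at, this]
  · refine ⟨⟨fun _ => 0, fun _ _ _ => le_rfl⟩, ?_⟩
    simp [enc, Bid.at]

/-! ### The minimizer -/

/-- Holds at `t = 0` too, where division by zero gives `0` on both sides; hence the potential starts
at `0`. -/
theorem eta_inv (t : ℕ) : (eta t)⁻¹ = √(t : ℝ) := by
  rw [eta, one_div, inv_inv]

theorem objective_eq (γ : ℝ) (t : ℕ) (L x : Coord K M → ℝ) :
    objective γ t L x = ∑ i, x i * L i + √(t : ℝ) * ∑ i, psi γ (x i) := by
  rw [objective, eta_inv, regularizer_eq_sum_psi]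

theorem minimizer_mem (γ : ℝ) (t : ℕ) (L : Coord K M → ℝ) : minimizer γ t L ∈ convH K M :=
  (exists_minimizer γ t L).choose_spec.1

theorem objective_minimizer_le (γ : ℝ) (t : ℕ) (L : Coord K M → ℝ) {y : Coord K M → ℝ}
    (hy : y ∈ convH K M) : objective γ t L (minimizer γ t L) ≤ objective γ t L y :=
  (exists_minimizer γ t L).choose_spec.2 hy

theorem segment_mem_convH {x y : Coord K M → ℝ} (hx : x ∈ convH K M) (hy : y ∈ convH K M) {s : ℝ}
    (h0 : 0 ≤ s) (h1 : s ≤ 1) : (fun i => x i + s * (y i - x i)) ∈ convH K M :=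
  convex_convH.add_smul_sub_mem hx hy ⟨h0, h1⟩

/-- Moving from the minimizer a little way towards `y`, the regularizer of a single coordinate
decreases at most linearly. -/
theorem minimizer_coord_decrease_le {γ : ℝ} (hγ : 0 ≤ γ) (t : ℕ) (L : Coord K M → ℝ)
    {y : Coord K M → ℝ} (hy : y ∈ convH K M) (i : Coord K M) :
    ∃ C : ℝ, ∀ s : ℝ, 0 < s → s ≤ 1 →
      √(t : ℝ) * (psi γ (minimizer γ t L i) -
        psi γ (minimizer γ t L i + s * (y i - minimizer γ t L i))) ≤ s * C := by
  classical
  set x := minimizer γ t L with hx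
  have hxm : x ∈ convH K M := minimizer_mem γ t L
  refine ⟨∑ j, (y j - x j) * L j +
    √(t : ℝ) * ∑ j ∈ Finset.univ.erase i, (psi γ (y j) - psi γ (x j)), fun s hs0 hs1 => ?_⟩
  have hmin := objective_minimizer_le γ t L (segment_mem_convH hxm hy hs0.le hs1)
  rw [← hx, objective_eq, objective_eq] at hmin
  have hconv : ∀ j, psi γ (x j + s * (y j - x j)) - psi γ (x j) ≤ s * (psi γ (y j) - psi γ (x j)) := by
    intro j
    have h := (convexOn_psi hγ).2 (mem_Icc_of_mem_convH hxm j) (mem_Icc_of_mem_convH hy j)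
      (sub_nonneg.mpr hs1) hs0.le (by ring)
    have e : (1 - s) • x j + s • y j = x j + s * (y j - x j) := by
      simp only [smul_eq_mul]
      ring
    rw [e, smul_eq_mul, smul_eq_mul] at h
    linarith
  have hsum := Finset.sum_le_sum fun j (_ : j ∈ Finset.univ.erase i) => hconv j
  have hE1 : ∑ j, psi γ (x j + s * (y j - x j)) - ∑ j, psi γ (x j) =
      (psi γ (x i + s * (y i - x i)) - psi γ (x i)) +
        ∑ j ∈ Finset.univ.erase i, (psi γ (x j + s * (y j - x j)) - psi γ (x j)) := by
    rw [← Finset.sum_sub_distrib]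
    exact (Finset.add_sum_erase _ _ (Finset.mem_univ i)).symm
  have hE2 : ∑ j, (x j + s * (y j - x j)) * L j = ∑ j, x j * L j + s * ∑ j, (y j - x j) * L j := by
    rw [Finset.mul_sum, ← Finset.sum_add_distrib]
    exact Finset.sum_congr rfl fun j _ => by ring
  rw [← Finset.mul_sum] at hsum
  have hsum2 := mul_le_mul_of_nonneg_left hsum (Real.sqrt_nonneg (t : ℝ))
  have hE3 := congrArg (fun z => √(t : ℝ) * z) hE1
  rw [hE2] at hmin
  linarith

/-- The square root has infinite slope at `0`: a step `e ^ 2` towards a vertex with coordinate `1`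
gains at least a multiple of `e` but costs only order `e ^ 2`. -/
theorem minimizer_pos {γ : ℝ} (hγ : 0 ≤ γ) (t : ℕ) (L : Coord K M → ℝ) (i : Coord K M) :
    0 < minimizer γ (t + 1) L i := by
  refine (mem_Icc_of_mem_convH (minimizer_mem γ (t + 1) L) i).1.lt_of_ne' fun h0 => ?_
  obtain ⟨b, hb⟩ := exists_enc_eq_one i
  obtain ⟨C, hC⟩ := minimizer_coord_decrease_le hγ (t + 1) L (enc_mem_convH b) i
  rw [h0, hb] at hC
  have hr : 0 < √((t + 1 : ℕ) : ℝ) := Real.sqrt_pos.mpr (by positivity)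
  obtain ⟨d, hd0, hd⟩ := exists_pos_mul_lt hr |C|
  set e := min d 1 with he
  have he0 : 0 < e := lt_min hd0 one_pos
  have he1 : e ≤ 1 := min_le_right _ _
  have h := hC (e ^ 2) (by positivity) (by nlinarith)
  have hlog : Real.log (1 - e ^ 2) ≤ 0 := Real.log_nonpos (by nlinarith) (by nlinarith)
  have hpsi : e ≤ psi γ 0 - psi γ (0 + e ^ 2 * (1 - 0)) := by
    simp only [psi, Real.sqrt_zero, sub_zero, Real.log_one, mul_zero, neg_zero, add_zero, mul_one,
      zero_add, zero_sub, Real.sqrt_sq he0.le]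
    have : γ * ((1 - e ^ 2) * Real.log (1 - e ^ 2)) ≤ 0 :=
      mul_nonpos_of_nonneg_of_nonpos hγ (mul_nonpos_of_nonneg_of_nonpos (by nlinarith) hlog)
    linarith
  have h2 := (mul_le_mul_of_nonneg_left hpsi hr.le).trans h
  have h3 : √((t + 1 : ℕ) : ℝ) ≤ e * C := by
    have : √((t + 1 : ℕ) : ℝ) * e ≤ (e * C) * e := by linarith
    exact le_of_mul_le_mul_right this he0
  have h4 : e * C ≤ |C| * d := by
    have := mul_le_mul_of_nonneg_left (le_abs_self C) he0.le
    have := mul_le_mul_of_nonneg_right (min_le_left d 1) (abs_nonneg C)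
    linarith
  linarith

theorem minimizer_lt_one {γ : ℝ} (hM : 0 < M) (hγ : 0 < γ) (t : ℕ) (L : Coord K M → ℝ)
    (i : Coord K M) : minimizer γ (t + 1) L i < 1 := by
  refine (mem_Icc_of_mem_convH (minimizer_mem γ (t + 1) L) i).2.lt_of_ne fun h0 => ?_
  obtain ⟨b, hb⟩ := exists_enc_eq_zero hM i
  obtain ⟨C, hC⟩ := minimizer_coord_decrease_le hγ.le (t + 1) L (enc_mem_convH b) i
  rw [h0, hb] at hC
  have hr : 0 < √((t + 1 : ℕ) : ℝ) := Real.sqrt_pos.mpr (by positivity)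
  -- With step `exp (-A)` the entropy gains `γ * A` per unit of step; this `A` makes the net gain
  -- `|C| + √(t + 1) * γ`, more than the linear cost allows.
  set A := (|C| / √((t + 1 : ℕ) : ℝ) + 1) / γ + 1 with hA
  have hA0 : 0 < A := by positivity
  set s := Real.exp (-A) with hs
  have hs0 : 0 < s := Real.exp_pos _
  have hs1 : s ≤ 1 := Real.exp_le_one_iff.mpr (by linarith)
  have h := hC s hs0 hs1
  have hpsi : s * (γ * A - 1) ≤ psi γ 1 - psi γ (1 + s * (0 - 1)) := by
    have e : 1 - (1 + s * (0 - 1)) = s := by ring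
    have e2 : 1 + s * (0 - 1) = 1 - s := by ring
    have hq : 1 - s ≤ √(1 - s) := le_sqrt_self (by linarith) (by linarith)
    simp only [psi, e, Real.sqrt_one, sub_self, zero_mul, mul_zero, add_zero]
    rw [e2, hs, Real.log_exp, ← hs]
    linarith
  have h2 := (mul_le_mul_of_nonneg_left hpsi hr.le).trans h
  have h3 : √((t + 1 : ℕ) : ℝ) * (γ * A - 1) ≤ C := by
    have : s * (√((t + 1 : ℕ) : ℝ) * (γ * A - 1)) ≤ s * C := by linarith
    exact le_of_mul_le_mul_left this hs0
  have e : √((t + 1 : ℕ) : ℝ) * (γ * A - 1) = |C| + √((t + 1 : ℕ) : ℝ) * γ := by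
    rw [hA]
    field_simp
    ring
  have := le_abs_self C
  have := mul_pos hr hγ
  linarith

/-- The objective is linear plus `r` times a sum of `psi`, so its increase from `x` to `y` is the
directional derivative at `x` plus `r` times the divergence. At the interior minimizer that
derivative exists, and it is nonnegative because the segment stays in the polytope. -/
theorem objective_minimizer_add_breg_le {γ : ℝ} (hM : 0 < M) (hγ : 0 < γ) (t : ℕ)
    (L : Coord K M → ℝ) {y : Coord K M → ℝ} (hy : y ∈ convH K M) :
    objective γ (t + 1) L (minimizer γ (t + 1) L) +
      √((t + 1 : ℕ) : ℝ) * ∑ i, breg γ (y i) (minimizer γ (t + 1) L i) ≤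
      objective γ (t + 1) L y := by
  set x := minimizer γ (t + 1) L with hx
  set r := √((t + 1 : ℕ) : ℝ) with hr
  have hxm : x ∈ convH K M := minimizer_mem γ (t + 1) L
  let D : ℝ := ∑ i, (y i - x i) * L i + r * ∑ i, psiDeriv γ (x i) * (y i - x i)
  let φ : ℝ → ℝ := fun s => objective γ (t + 1) L fun i => x i + s * (y i - x i)
  have hline : ∀ i, HasDerivAt (fun s : ℝ => x i + s * (y i - x i)) (y i - x i) 0 := fun i => by
    simpa using ((hasDerivAt_id (0 : ℝ)).mul_const (y i - x i)).const_add (x i)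
  have hφ : HasDerivAt φ D 0 := by
    have h1 : HasDerivAt (fun s : ℝ => ∑ i, (x i + s * (y i - x i)) * L i)
        (∑ i, (y i - x i) * L i) 0 :=
      HasDerivAt.fun_sum fun i _ => (hline i).mul_const (L i)
    have h2 : HasDerivAt (fun s : ℝ => ∑ i, psi γ (x i + s * (y i - x i)))
        (∑ i, psiDeriv γ (x i) * (y i - x i)) 0 := by
      refine HasDerivAt.fun_sum fun i _ => ?_
      have h := hasDerivAt_psi γ (minimizer_pos hγ.le t L i) (minimizer_lt_one hM hγ t L i)
      have e : x i = x i + 0 * (y i - x i) := by ring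
      rw [← hx] at h
      exact HasDerivAt.comp (h₂ := psi γ) (0 : ℝ) (by rw [← e]; exact h) (hline i)
    have h3 := h1.add (h2.const_mul r)
    refine h3.congr_of_eventuallyEq (Filter.Eventually.of_forall fun s => ?_)
    simp only [φ, objective_eq]
    rfl
  have hφ0 : φ 0 = objective γ (t + 1) L x := by simp [φ]
  have hD : 0 ≤ D := by
    have hs := (hasDerivAt_iff_tendsto_slope.mp hφ).mono_left
      (nhdsWithin_mono 0 (fun s (hs : s ∈ Set.Ioi (0 : ℝ)) => ne_of_gt hs))
    refine ge_of_tendsto hs ?_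
    filter_upwards [Ioc_mem_nhdsGT (zero_lt_one (α := ℝ))] with s hs
    rw [slope_def_field, hφ0]
    refine div_nonneg (sub_nonneg.mpr ?_) (by linarith [hs.1])
    exact objective_minimizer_le γ (t + 1) L (segment_mem_convH hxm hy hs.1.le hs.2)
  have e : objective γ (t + 1) L y = objective γ (t + 1) L x + r * ∑ i, breg γ (y i) (x i) + D := by
    simp only [objective_eq, D, breg, Finset.sum_sub_distrib, sub_mul, ← hr]
    ring
  linarith

/-! ### One round of the potential -/

/-- Gap between the regularized cumulative loss of the bid `b₀` and the minimal one. -/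
noncomputable def potential (γ : ℝ) (b₀ : Bid K M) (t : ℕ) (L : Coord K M → ℝ) : ℝ :=
  objective γ t L (enc b₀) - objective γ t L (minimizer γ t L)

theorem potential_nonneg (γ : ℝ) (b₀ : Bid K M) (t : ℕ) (L : Coord K M → ℝ) :
    0 ≤ potential γ b₀ t L :=
  sub_nonneg.mpr (objective_minimizer_le γ t L (enc_mem_convH b₀))

theorem potential_zero (γ : ℝ) (b₀ : Bid K M) : potential γ b₀ 0 0 = 0 := by
  simp [potential, objective_eq]

theorem sqrt_succ_sub_sqrt_le (t : ℕ) :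
    √((t + 1 : ℕ) : ℝ) - √(t : ℝ) ≤ 1 / √((t + 1 : ℕ) : ℝ) := by
  have hr : 0 < √((t + 1 : ℕ) : ℝ) := Real.sqrt_pos.mpr (by positivity)
  rw [le_div_iff₀ hr]
  have h1 := Real.sq_sqrt (Nat.cast_nonneg (α := ℝ) (t + 1))
  have h2 := Real.sq_sqrt (Nat.cast_nonneg (α := ℝ) t)
  have h3 : √(t : ℝ) ≤ √((t + 1 : ℕ) : ℝ) := Real.sqrt_le_sqrt (by push_cast; linarith)
  have h4 := mul_le_mul_of_nonneg_left h3 (Real.sqrt_nonneg (t : ℝ))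
  push_cast at *
  nlinarith

theorem potential_succ_le {γ : ℝ} (hM : 0 < M) (hγ0 : 0 < γ) (hγ1 : γ ≤ 1) (b₀ : Bid K M) (t : ℕ)
    (L : Coord K M → ℝ) (b : Bid K M) (w : Coord K M → ℝ) (hw : ∀ i, |w i| ≤ K) :
    potential γ b₀ (t + 1)
      (L + lossEstimate (minimizer γ (t + 1) L) b (fun i => enc b i * w i)) ≤
      potential γ b₀ t L +
      ∑ i, (enc b₀ i - minimizer γ (t + 1) L i) *
        lossEstimate (minimizer γ (t + 1) L) b (fun i => enc b i * w i) i +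
      (∑ i, 2 * √|minimizer γ (t + 1) L i - enc b₀ i|) / √((t + 1 : ℕ) : ℝ) +
      (∑ i, (stabBase K γ (minimizer γ (t + 1) L i) +
        stabPlayed K (minimizer γ (t + 1) L i) * enc b i)) / √((t + 1 : ℕ) : ℝ) := by
  set x := minimizer γ (t + 1) L with hx
  set l := lossEstimate x b (fun i => enc b i * w i) with hl
  set r := √((t + 1 : ℕ) : ℝ) with hr
  have hxm : x ∈ convH K M := minimizer_mem γ (t + 1) L
  set y := minimizer γ (t + 1) (L + l) with hy
  have hym : y ∈ convH K M := minimizer_mem γ (t + 1) (L + l)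
  have hr1 : 1 ≤ r := by
    rw [hr, Real.one_le_sqrt]
    push_cast
    linarith [Nat.cast_nonneg (α := ℝ) t]
  have hr0 : 0 < r := by linarith
  have hbreg := objective_minimizer_add_breg_le hM hγ0 t L hym
  rw [← hx, ← hr] at hbreg
  have hstab : ∑ i, (x i - y i) * l i - r * ∑ i, breg γ (y i) (x i) ≤
      (∑ i, (stabBase K γ (x i) + stabPlayed K (x i) * enc b i)) / r := by
    rw [Finset.mul_sum, ← Finset.sum_sub_distrib, Finset.sum_div]
    refine Finset.sum_le_sum fun i _ => ?_
    exact stability_coord hγ0 hr1 (minimizer_pos hγ0.le t L i) (minimizer_lt_one hM hγ0 t L i)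
      (mem_Icc_of_mem_convH hym i).1 (mem_Icc_of_mem_convH hym i).2 (hw i)
      (enc_eq_zero_or_one b i)
  have hpen : (r - √(t : ℝ)) * (∑ i, psi γ (enc b₀ i) - ∑ i, psi γ (x i)) ≤
      (∑ i, 2 * √|x i - enc b₀ i|) / r := by
    have h1 : ∑ i, psi γ (enc b₀ i) - ∑ i, psi γ (x i) ≤ ∑ i, 2 * √|x i - enc b₀ i| := by
      rw [← Finset.sum_sub_distrib]
      exact Finset.sum_le_sum fun i _ => psi_sub_psi_le hγ1 (mem_Icc_of_mem_convH hxm i).1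
        (mem_Icc_of_mem_convH hxm i).2 (enc_eq_zero_or_one b₀ i)
    have h2 : 0 ≤ ∑ i, 2 * √|x i - enc b₀ i| := by positivity
    have h3 : 0 ≤ r - √(t : ℝ) :=
      sub_nonneg.mpr (Real.sqrt_le_sqrt (by push_cast; linarith))
    have h4 := sqrt_succ_sub_sqrt_le t
    rw [← hr] at h4
    refine (mul_le_mul_of_nonneg_left h1 h3).trans ?_
    refine (mul_le_mul_of_nonneg_right h4 h2).trans_eq ?_
    ring
  -- The new point competes in the objective with the old learning rate, so the change of rate costs
  -- only `(r - √t)` times a difference of regularizers.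
  have hmono := objective_minimizer_le γ t L hxm
  have e : ∀ z : Coord K M → ℝ,
      objective γ (t + 1) (L + l) z = objective γ (t + 1) L z + ∑ i, z i * l i := by
    intro z
    simp only [objective_eq, Pi.add_apply, mul_add, Finset.sum_add_distrib]
    ring
  simp only [potential, ← hy, e]
  simp only [sub_mul, Finset.sum_sub_distrib] at hstab ⊢
  simp only [objective_eq, ← hr] at hbreg hmono ⊢
  linarith

/-! ### Expectations over finite spaces -/

section Expect

variable {α β : Type} [Fintype α] [Fintype β]

theorem sum_toReal_pmf (p : PMF α) : ∑ a, (p a).toReal = 1 := by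
  have h := p.tsum_coe
  rw [tsum_fintype] at h
  rw [← ENNReal.toReal_sum fun a _ => p.apply_ne_top a, h, ENNReal.toReal_one]

theorem expect_const (p : PMF α) (r : ℝ) : expect p (fun _ => r) = r := by
  rw [expect, ← Finset.sum_mul, sum_toReal_pmf, one_mul]

theorem expect_add (p : PMF α) (f g : α → ℝ) :
    expect p (fun a => f a + g a) = expect p f + expect p g := by
  simp only [expect, mul_add, Finset.sum_add_distrib]

theorem expect_sub (p : PMF α) (f g : α → ℝ) :
    expect p (fun a => f a - g a) = expect p f - expect p g := by
  simp only [expect, mul_sub, Finset.sum_sub_distrib]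

theorem expect_const_mul (p : PMF α) (r : ℝ) (f : α → ℝ) :
    expect p (fun a => r * f a) = r * expect p f := by
  simp only [expect, Finset.mul_sum, mul_left_comm]

theorem expect_sum {ι : Type} (p : PMF α) (s : Finset ι) (f : ι → α → ℝ) :
    expect p (fun a => ∑ i ∈ s, f i a) = ∑ i ∈ s, expect p (f i) := by
  simp only [expect, Finset.mul_sum]
  exact Finset.sum_comm

theorem expect_mono (p : PMF α) {f g : α → ℝ} (h : ∀ a, f a ≤ g a) : expect p f ≤ expect p g :=
  Finset.sum_le_sum fun a _ => mul_le_mul_of_nonneg_left (h a) ENNReal.toReal_nonneg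

theorem expect_nonneg (p : PMF α) {f : α → ℝ} (h : ∀ a, 0 ≤ f a) : 0 ≤ expect p f :=
  Finset.sum_nonneg fun a _ => mul_nonneg ENNReal.toReal_nonneg (h a)

theorem abs_expect_le (p : PMF α) (f : α → ℝ) : |expect p f| ≤ expect p (fun a => |f a|) := by
  refine (Finset.abs_sum_le_sum_abs _ _).trans_eq (Finset.sum_congr rfl fun a _ => ?_)
  rw [abs_mul, abs_of_nonneg ENNReal.toReal_nonneg]

theorem expect_comm (p : PMF α) (q : PMF β) (f : α → β → ℝ) :
    expect p (fun a => expect q (f a)) = expect q (fun b => expect p fun a => f a b) := by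
  simp only [expect, Finset.mul_sum]
  rw [Finset.sum_comm]
  exact Finset.sum_congr rfl fun b _ => Finset.sum_congr rfl fun a _ => by ring

theorem expect_pure (a : α) (f : α → ℝ) : expect (PMF.pure a) f = f a := by
  classical
  rw [expect, Finset.sum_eq_single a]
  · simp
  · intro b _ hb
    simp [PMF.pure_apply, hb]
  · simp

theorem expect_bind (p : PMF α) (g : α → PMF β) (f : β → ℝ) :
    expect (p.bind g) f = expect p fun a => expect (g a) f := by
  simp only [expect, Finset.mul_sum]
  rw [Finset.sum_comm]
  refine Finset.sum_congr rfl fun b _ => ?_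
  rw [PMF.bind_apply, tsum_fintype, ENNReal.toReal_sum, Finset.sum_mul]
  · refine Finset.sum_congr rfl fun a _ => ?_
    rw [ENNReal.toReal_mul, mul_assoc]
  · exact fun a _ => ENNReal.mul_ne_top (p.apply_ne_top a) ((g a).apply_ne_top b)

end Expect

/-! ### One round of the algorithm in expectation -/

/-- Distance of `x` from the vertex of the bid `b₀`, in the scale that governs the regret. -/
noncomputable def vertexGap (b₀ : Bid K M) (x : Coord K M → ℝ) : ℝ := ∑ i, √|x i - enc b₀ i|

/-- Constant of the regret contributed by a single round. -/
noncomputable def roundConst (K : ℕ) (γ : ℝ) : ℝ := 2 + (10 * (K : ℝ) ^ 2 + logConst K γ)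

theorem roundConst_nonneg (K : ℕ) {γ : ℝ} (hγ : 0 < γ) : 0 ≤ roundConst K γ := by
  have := logConst_nonneg K hγ
  unfold roundConst
  positivity

theorem vertexGap_le_of_abs_sub_le {b₀ : Bid K M} {x : Coord K M → ℝ} {q : ℝ}
    (h : ∀ i, |x i - enc b₀ i| ≤ q) : vertexGap b₀ x ≤ Fintype.card (Coord K M) * √q := by
  refine (Finset.sum_le_card_nsmul _ _ _ fun i _ => Real.sqrt_le_sqrt (h i)).trans_eq ?_
  rw [nsmul_eq_mul, Finset.card_univ]

theorem expect_enc (P : SamplingScheme K M) {x : Coord K M → ℝ} (hx : x ∈ convH K M)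
    (i : Coord K M) : expect (P.sample x) (fun b => enc b i) = x i := P.mean x hx i

/-- Importance weighting by the playing probability `x i` recovers `K - w i` in mean, and the final
`-K` undoes the shift. -/
theorem expect_lossEstimate (P : SamplingScheme K M) {x : Coord K M → ℝ} (hx : x ∈ convH K M)
    {i : Coord K M} (hi : x i ≠ 0) (w : Coord K M → ℝ) :
    expect (P.sample x) (fun b => lossEstimate x b (fun i => enc b i * w i) i) = -w i := by
  have e : ∀ b : Bid K M, lossEstimate x b (fun i => enc b i * w i) i =
      ((K - w i) / x i) * enc b i - K := by
    intro b
    have h := enc_mul_self b i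
    simp only [lossEstimate]
    have : (-(enc b i * w i) + K) * enc b i = (K - w i) * enc b i := by
      linear_combination -(w i) * h
    rw [this]
    ring
  simp only [e]
  rw [expect_sub, expect_const_mul, expect_const, expect_enc P hx]
  field_simp
  ring

theorem expect_utility_eq {c : Fin K → ℝ} {W : Bid K M → Coord K M → ℝ} (hW : IsWeightMap c W)
    (P : SamplingScheme K M) {x : Coord K M → ℝ} (hx : x ∈ convH K M) (β : Bid K M) :
    expect (P.sample x) (fun b => utility c b β) = ∑ i, x i * W β i := by
  simp only [hW.1]
  rw [expect_sum]
  refine Finset.sum_congr rfl fun i _ => ?_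
  simp only [mul_comm _ (W β i)]
  rw [expect_const_mul, expect_enc P hx]

/-- By unbiasedness the linear term of `potential_succ_le` averages to minus the instantaneous
regret, which the added utility difference cancels. -/
theorem expect_potential_succ_le {γ : ℝ} (hM : 0 < M) (hγ0 : 0 < γ) (hγ1 : γ ≤ 1)
    {c : Fin K → ℝ} {W : Bid K M → Coord K M → ℝ} (hW : IsWeightMap c W)
    (P : SamplingScheme K M) (b₀ : Bid K M) (t : ℕ) (L : Coord K M → ℝ) (β : Bid K M) :
    expect (P.sample (minimizer γ (t + 1) L)) (fun b => potential γ b₀ (t + 1)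
        (L + lossEstimate (minimizer γ (t + 1) L) b (outcome W b β)) +
        (utility c b₀ β - utility c b β)) ≤
      potential γ b₀ t L +
        roundConst K γ / √((t + 1 : ℕ) : ℝ) * vertexGap b₀ (minimizer γ (t + 1) L) := by
  have hr : 0 < √((t + 1 : ℕ) : ℝ) := Real.sqrt_pos.mpr (by positivity)
  have hpt := fun b => potential_succ_le hM hγ0 hγ1 b₀ t L b (W β) (hW.2 β)
  have hx0 := fun i => minimizer_pos hγ0.le t L i
  have hx1 := fun i => minimizer_lt_one hM hγ0 t L i
  have hxm := minimizer_mem γ (t + 1) L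
  set x := minimizer γ (t + 1) L with hx
  set r := √((t + 1 : ℕ) : ℝ)
  rw [expect_add, expect_sub, expect_const, expect_utility_eq hW P hxm]
  have h1 := expect_mono (P.sample x) hpt
  rw [expect_add, expect_add, expect_add, expect_const, expect_const, expect_sum] at h1
  have h2 : ∑ i, expect (P.sample x) (fun b => (enc b₀ i - x i) *
      lossEstimate x b (fun i => enc b i * W β i) i) = ∑ i, x i * W β i - utility c b₀ β := by
    rw [hW.1, ← Finset.sum_sub_distrib]
    refine Finset.sum_congr rfl fun i _ => ?_
    rw [expect_const_mul, expect_lossEstimate P hxm (hx0 i).ne']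
    ring
  have h3 : expect (P.sample x) (fun b => (∑ i, (stabBase K γ (x i) +
      stabPlayed K (x i) * enc b i)) / r) ≤
      (10 * (K : ℝ) ^ 2 + logConst K γ) * vertexGap b₀ x / r := by
    have e : ∀ b : Bid K M, (∑ i, (stabBase K γ (x i) + stabPlayed K (x i) * enc b i)) / r =
        r⁻¹ * ∑ i, (stabBase K γ (x i) + stabPlayed K (x i) * enc b i) := fun b => by
      rw [div_eq_mul_inv, mul_comm]
    simp only [e]
    rw [expect_const_mul, expect_sum, div_eq_mul_inv, mul_comm _ r⁻¹, vertexGap,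
      Finset.mul_sum _ _ (10 * (K : ℝ) ^ 2 + logConst K γ)]
    refine mul_le_mul_of_nonneg_left (Finset.sum_le_sum fun i _ => ?_) (inv_nonneg.mpr hr.le)
    rw [expect_add, expect_const, expect_const_mul, expect_enc P hxm]
    exact stab_mean_le hγ0 K (hx0 i) (hx1 i) (enc_eq_zero_or_one b₀ i)
  rw [h2] at h1
  have h4 : (∑ i, 2 * √|x i - enc b₀ i|) / r = 2 * vertexGap b₀ x / r := by
    rw [vertexGap, Finset.mul_sum]
  rw [h4] at h1
  have h5 : roundConst K γ / r * vertexGap b₀ x = 2 * vertexGap b₀ x / r +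
      (10 * (K : ℝ) ^ 2 + logConst K γ) * vertexGap b₀ x / r := by
    rw [roundConst]
    ring
  rw [h5]
  have h6 : expect (P.sample x) (fun b => potential γ b₀ (t + 1)
      (L + lossEstimate x b (outcome W b β))) = expect (P.sample x) (fun b =>
      potential γ b₀ (t + 1) (L + lossEstimate x b (fun i => enc b i * W β i))) := rfl
  rw [h6]
  linarith

/-! ### The run of the algorithm -/

/-- The point computed in round `t + 1` after the history `ω`. -/
noncomputable def play (γ : ℝ) (W : Bid K M → Coord K M → ℝ) (t : ℕ)
    (ω : Fin t → Bid K M × Bid K M) : Coord K M → ℝ :=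
  minimizer γ (t + 1) (cumEstimate γ W t ω)

theorem play_mem (γ : ℝ) (W : Bid K M → Coord K M → ℝ) (t : ℕ) (ω : Fin t → Bid K M × Bid K M) :
    play γ W t ω ∈ convH K M := minimizer_mem _ _ _

theorem expect_law_succ (γ : ℝ) (W : Bid K M → Coord K M → ℝ) (P : SamplingScheme K M)
    (env : ℕ → PMF (Bid K M)) (t : ℕ) (f : (Fin (t + 1) → Bid K M × Bid K M) → ℝ) :
    expect (law γ W P env (t + 1)) f =
      expect (law γ W P env t) fun ω => expect (P.sample (play γ W t ω)) fun b =>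
        expect (env t) fun β =>
          f (Fin.snoc (α := fun _ => Bid K M × Bid K M) ω (b, β)) := by
  rw [law, expect_bind]
  simp only [expect_bind, expect_pure]
  rfl

theorem cumEstimate_snoc (γ : ℝ) (W : Bid K M → Coord K M → ℝ) (t : ℕ)
    (ω : Fin t → Bid K M × Bid K M) (b β : Bid K M) :
    cumEstimate γ W (t + 1) (Fin.snoc (α := fun _ => Bid K M × Bid K M) ω (b, β)) =
      cumEstimate γ W t ω + lossEstimate (play γ W t ω) b (outcome W b β) := by
  simp only [cumEstimate, play, Fin.init_snoc, Fin.snoc_last]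

theorem sum_snoc (f : Bid K M → Bid K M → ℝ) (t : ℕ) (ω : Fin t → Bid K M × Bid K M)
    (b β : Bid K M) :
    (∑ s, f (Fin.snoc (α := fun _ => Bid K M × Bid K M) ω (b, β) s).1
      (Fin.snoc (α := fun _ => Bid K M × Bid K M) ω (b, β) s).2) =
      ∑ s, f (ω s).1 (ω s).2 + f b β := by
  rw [Fin.sum_univ_castSucc]
  simp only [Fin.snoc_castSucc, Fin.snoc_last]

theorem expect_law_sum (γ : ℝ) (W : Bid K M → Coord K M → ℝ) (P : SamplingScheme K M)
    (env : ℕ → PMF (Bid K M)) (f : Bid K M → Bid K M → ℝ) (T : ℕ) :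
    expect (law γ W P env T) (fun ω => ∑ s, f (ω s).1 (ω s).2) =
      ∑ t ∈ Finset.range T, expect (law γ W P env t) fun ω =>
        expect (P.sample (play γ W t ω)) fun b => expect (env t) (f b) := by
  induction T with
  | zero => simp [expect]
  | succ T ih =>
    rw [expect_law_succ, Finset.sum_range_succ, ← ih, ← expect_add]
    simp only [sum_snoc, expect_add, expect_const]

theorem expect_regret_le {γ : ℝ} (hM : 0 < M) (hγ0 : 0 < γ) (hγ1 : γ ≤ 1) {c : Fin K → ℝ}
    {W : Bid K M → Coord K M → ℝ} (hW : IsWeightMap c W) (P : SamplingScheme K M)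
    (env : ℕ → PMF (Bid K M)) (b₀ : Bid K M) (T : ℕ) :
    expect (law γ W P env T)
        (fun ω => ∑ s, (utility c b₀ (ω s).2 - utility c (ω s).1 (ω s).2)) ≤
      ∑ t ∈ Finset.range T, roundConst K γ / √((t + 1 : ℕ) : ℝ) *
        expect (law γ W P env t) fun ω => vertexGap b₀ (play γ W t ω) := by
  have key : ∀ T, expect (law γ W P env T) (fun ω => potential γ b₀ T (cumEstimate γ W T ω) +
      ∑ s, (utility c b₀ (ω s).2 - utility c (ω s).1 (ω s).2)) ≤
      ∑ t ∈ Finset.range T, roundConst K γ / √((t + 1 : ℕ) : ℝ) *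
        expect (law γ W P env t) fun ω => vertexGap b₀ (play γ W t ω) := by
    intro T
    induction T with
    | zero =>
      rw [law, expect_pure]
      simp [cumEstimate, potential_zero]
    | succ T ih =>
      rw [expect_law_succ, Finset.sum_range_succ]
      refine le_trans ?_ (add_le_add_left ih _)
      rw [← expect_const_mul, ← expect_add]
      refine expect_mono _ fun ω => ?_
      simp only [cumEstimate_snoc,
        sum_snoc (fun b β => utility c b₀ β - utility c b β)]
      -- The two bids of a round are independent given the past, so the bound for a fixed opposing
      -- bid applies first.
      rw [expect_comm]
      rw [← expect_const (env T) (_ + _)]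
      refine expect_mono _ fun β => ?_
      have h := expect_potential_succ_le hM hγ0 hγ1 hW P b₀ T (cumEstimate γ W T ω) β
      rw [expect_add] at h ⊢
      rw [expect_add, expect_const]
      simp only [play]
      linarith
  refine le_trans (expect_mono _ fun ω => ?_) (key T)
  have := potential_nonneg γ b₀ T (cumEstimate γ W T ω)
  linarith

/-! ### Adversarial opposing bids -/

theorem sum_one_div_sqrt_le (T : ℕ) :
    ∑ t ∈ Finset.range T, 1 / √((t + 1 : ℕ) : ℝ) ≤ 2 * √(T : ℝ) := by
  induction T with
  | zero => simp
  | succ T ih =>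
    rw [Finset.sum_range_succ]
    have hr : 0 < √((T + 1 : ℕ) : ℝ) := Real.sqrt_pos.mpr (by positivity)
    have h : 1 / √((T + 1 : ℕ) : ℝ) ≤ 2 * √((T + 1 : ℕ) : ℝ) - 2 * √(T : ℝ) := by
      rw [div_le_iff₀ hr]
      have h1 := Real.sq_sqrt (Nat.cast_nonneg (α := ℝ) (T + 1))
      have h2 := Real.sq_sqrt (Nat.cast_nonneg (α := ℝ) T)
      push_cast at *
      nlinarith [sq_nonneg (√((T : ℝ) + 1) - √(T : ℝ))]
    linarith

theorem regret_le_sqrt {γ : ℝ} (hM : 0 < M) (hγ0 : 0 < γ) (hγ1 : γ ≤ 1) {c : Fin K → ℝ}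
    {W : Bid K M → Coord K M → ℝ} (hW : IsWeightMap c W) (P : SamplingScheme K M)
    (β : ℕ → Bid K M) (T : ℕ) :
    regret c γ W P β T ≤ 2 * roundConst K γ * Fintype.card (Coord K M) * √(T : ℝ) := by
  refine ciSup_le fun b₀ => ?_
  simp only [← Finset.sum_sub_distrib]
  refine (expect_regret_le hM hγ0 hγ1 hW P _ b₀ T).trans ?_
  have hC := roundConst_nonneg K hγ0
  have hgap : ∀ t, expect (law γ W P (fun t => PMF.pure (β t)) t)
      (fun ω => vertexGap b₀ (play γ W t ω)) ≤ Fintype.card (Coord K M) := by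
    intro t
    refine (expect_mono _ fun ω => ?_).trans_eq (expect_const _ _)
    refine (vertexGap_le_of_abs_sub_le (q := 1) fun i => ?_).trans_eq (by simp)
    exact abs_sub_le_one (mem_Icc_of_mem_convH (play_mem γ W t ω) i)
      (mem_Icc_of_mem_convH (enc_mem_convH b₀) i)
  have h := mul_le_mul_of_nonneg_left (sum_one_div_sqrt_le T)
    (mul_nonneg hC (Nat.cast_nonneg (Fintype.card (Coord K M))))
  refine le_trans ?_ (h.trans_eq (by ring))
  rw [Finset.mul_sum]
  refine Finset.sum_le_sum fun t _ => ?_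
  refine (mul_le_mul_of_nonneg_left (hgap t) (by positivity)).trans_eq ?_
  ring

/-! ### Stochastic opposing bids -/

theorem exists_uniform_gap {α : Type} [Finite α] (a₀ : α) (g : α → ℝ)
    (h : ∀ a, a ≠ a₀ → 0 < g a) : ∃ δ : ℝ, 0 < δ ∧ ∀ a, a ≠ a₀ → δ ≤ g a := by
  classical
  have := Fintype.ofFinite α
  rcases (Finset.univ.erase a₀).eq_empty_or_nonempty with he | hne
  · refine ⟨1, one_pos, fun a ha => ?_⟩
    have : a ∈ Finset.univ.erase a₀ := Finset.mem_erase.mpr ⟨ha, Finset.mem_univ a⟩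
    simp [he] at this
  · obtain ⟨m, hm, hmin⟩ := Finset.exists_min_image _ g hne
    exact ⟨g m, h m (Finset.ne_of_mem_erase hm), fun a ha =>
      hmin a (Finset.mem_erase.mpr ⟨ha, Finset.mem_univ a⟩)⟩

open Classical in
-- Both sides compare the mean of a `0`-`1` coordinate with its value at `b₀`; they can differ only
-- when another bid is drawn.
theorem abs_sub_enc_le (P : SamplingScheme K M) {x : Coord K M → ℝ} (hx : x ∈ convH K M)
    (b₀ : Bid K M) (i : Coord K M) :
    |x i - enc b₀ i| ≤ expect (P.sample x) (fun b => if b = b₀ then 0 else 1) := by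
  rw [← expect_enc P hx i, ← expect_const (P.sample x) (enc b₀ i), ← expect_sub]
  refine (abs_expect_le _ _).trans (expect_mono _ fun b => ?_)
  split_ifs with h
  · simp [h]
  · exact abs_sub_le_one (mem_Icc_of_mem_convH (enc_mem_convH b) i)
      (mem_Icc_of_mem_convH (enc_mem_convH b₀) i)

theorem mul_sqrt_le {a δ q : ℝ} (hδ : 0 < δ) (hq : 0 ≤ q) :
    a * √q ≤ δ * q / 2 + a ^ 2 / (2 * δ) := by
  have h := Real.sq_sqrt hq
  have e : δ * q / 2 + a ^ 2 / (2 * δ) - a * √q = (δ * √q - a) ^ 2 / (2 * δ) := by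
    field_simp
    linear_combination -δ ^ 2 * h
  have : 0 ≤ (δ * √q - a) ^ 2 / (2 * δ) := by positivity
  linarith

theorem sum_one_div_succ_le {T : ℕ} (hT : 2 ≤ T) :
    ∑ t ∈ Finset.range T, 1 / ((t + 1 : ℕ) : ℝ) ≤ (1 / Real.log 2 + 1) * Real.log T := by
  have h := harmonic_le_one_add_log T
  have e : ((harmonic T : ℚ) : ℝ) = ∑ t ∈ Finset.range T, 1 / ((t + 1 : ℕ) : ℝ) := by
    rw [harmonic]
    push_cast
    simp only [one_div]
  rw [e] at h
  have hl : 0 < Real.log 2 := Real.log_pos one_lt_two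
  have h2 : Real.log 2 ≤ Real.log T := Real.log_le_log two_pos (by exact_mod_cast hT)
  -- The constant term of the harmonic bound is absorbed into the logarithm, which needs `2 ≤ T`.
  have h3 : 1 ≤ 1 / Real.log 2 * Real.log T := by
    rw [one_div, inv_mul_eq_div, le_div_iff₀ hl, one_mul]
    exact h2
  linarith

theorem pseudoRegret_eq {c : Fin K → ℝ} (γ : ℝ) (W : Bid K M → Coord K M → ℝ)
    (P : SamplingScheme K M) (D : PMF (Bid K M)) {b₀ : Bid K M}
    (hb : ∀ b, expect D (fun β => utility c b β) ≤ expect D (fun β => utility c b₀ β)) (T : ℕ) :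
    pseudoRegret c γ W P D T = ∑ t ∈ Finset.range T, expect (law γ W P (fun _ => D) t) fun ω =>
      expect (P.sample (play γ W t ω)) fun b =>
        expect D (fun β => utility c b₀ β) - expect D (fun β => utility c b β) := by
  have hsup : (⨆ b : Bid K M, expect D fun β => utility c b β) =
      expect D fun β => utility c b₀ β :=
    le_antisymm (ciSup_le hb) (le_ciSup (f := fun b => expect D fun β => utility c b β)
      (Set.finite_range _).bddAbove b₀)
  rw [pseudoRegret, hsup, expect_law_sum]
  simp only [expect_sub, expect_const, Finset.sum_sub_distrib, Finset.sum_const,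
    Finset.card_range, nsmul_eq_mul]

theorem pseudoRegret_le_log {γ : ℝ} (hM : 0 < M) (hγ0 : 0 < γ) (hγ1 : γ ≤ 1) {c : Fin K → ℝ}
    {W : Bid K M → Coord K M → ℝ} (hW : IsWeightMap c W) (P : SamplingScheme K M)
    (D : PMF (Bid K M)) {b₀ : Bid K M} {δ : ℝ} (hδ : 0 < δ)
    (hgap : ∀ b, b ≠ b₀ →
      δ ≤ expect D (fun β => utility c b₀ β) - expect D (fun β => utility c b β))
    {T : ℕ} (hT : 2 ≤ T) :
    pseudoRegret c γ W P D T ≤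
      (roundConst K γ * Fintype.card (Coord K M)) ^ 2 / δ * (1 / Real.log 2 + 1) *
        Real.log T := by
  classical
  set A := roundConst K γ * Fintype.card (Coord K M) with hA
  set Δ : Bid K M → ℝ := fun b =>
    expect D (fun β => utility c b₀ β) - expect D (fun β => utility c b β) with hΔ
  have hC := roundConst_nonneg K hγ0
  have hb : ∀ b, expect D (fun β => utility c b β) ≤ expect D (fun β => utility c b₀ β) := by
    intro b
    by_cases h : b = b₀
    · rw [h]
    · linarith [hgap b h]
  have hR := pseudoRegret_eq γ W P D hb T
  have hR2 := expect_regret_le hM hγ0 hγ1 hW P (fun _ => D) b₀ T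
  rw [expect_law_sum γ W P (fun _ => D) (fun b β => utility c b₀ β - utility c b β)] at hR2
  simp only [expect_sub D] at hR2
  rw [← hR] at hR2
  -- Young's inequality is weighted so that exactly half of the expected loss of the round appears;
  -- summed over rounds this is half of the pseudo-regret and moves to the left.
  have hround : ∀ t, roundConst K γ / √((t + 1 : ℕ) : ℝ) *
      expect (law γ W P (fun _ => D) t) (fun ω => vertexGap b₀ (play γ W t ω)) ≤
      (1 / 2) * expect (law γ W P (fun _ => D) t)
        (fun ω => expect (P.sample (play γ W t ω)) Δ) +
      A ^ 2 / (2 * δ) * (1 / ((t + 1 : ℕ) : ℝ)) := by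
    intro t
    rw [← expect_const_mul, ← expect_const_mul,
      ← expect_const (law γ W P (fun _ => D) t) (A ^ 2 / (2 * δ) * (1 / ((t + 1 : ℕ) : ℝ))),
      ← expect_add]
    refine expect_mono _ fun ω => ?_
    have hx := play_mem γ W t ω
    set x := play γ W t ω
    set q := expect (P.sample x) (fun b => if b = b₀ then 0 else 1) with hq
    have hq0 : 0 ≤ q := expect_nonneg _ fun b => by split_ifs <;> norm_num
    have h1 := vertexGap_le_of_abs_sub_le fun i => abs_sub_enc_le P hx b₀ i
    have h2 : δ * q ≤ expect (P.sample x) Δ := by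
      rw [hq, ← expect_const_mul]
      refine expect_mono _ fun b => ?_
      split_ifs with h
      · simp [hΔ, h]
      · rw [mul_one]
        exact hgap b h
    have h3 := mul_le_mul_of_nonneg_left h1
      (by positivity : 0 ≤ roundConst K γ / √((t + 1 : ℕ) : ℝ))
    have h4 := mul_sqrt_le (a := A / √((t + 1 : ℕ) : ℝ)) hδ hq0
    have e1 : roundConst K γ / √((t + 1 : ℕ) : ℝ) * (Fintype.card (Coord K M) * √q) =
        A / √((t + 1 : ℕ) : ℝ) * √q := by
      rw [hA]
      ring
    have e2 : (A / √((t + 1 : ℕ) : ℝ)) ^ 2 / (2 * δ) =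
        A ^ 2 / (2 * δ) * (1 / ((t + 1 : ℕ) : ℝ)) := by
      rw [div_pow, Real.sq_sqrt (Nat.cast_nonneg _)]
      ring
    rw [e2] at h4
    rw [← hq, e1] at h3
    linarith
  have hsum := hR2.trans (Finset.sum_le_sum fun t (_ : t ∈ Finset.range T) => hround t)
  rw [Finset.sum_add_distrib, ← Finset.mul_sum, ← Finset.mul_sum, ← hR] at hsum
  have hlog := mul_le_mul_of_nonneg_left (sum_one_div_succ_le hT)
    (by positivity : 0 ≤ A ^ 2 / (2 * δ))
  have e : A ^ 2 / δ * (1 / Real.log 2 + 1) * Real.log T =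
      2 * (A ^ 2 / (2 * δ) * ((1 / Real.log 2 + 1) * Real.log T)) := by
    field_simp
  rw [e]
  linarith

end FCR

theorem mainTheorem2 (K M : ℕ) (hM : 0 < M) (γ : ℝ) (hγ0 : 0 < γ) (hγ1 : γ ≤ 1) :
    (∀ c : Fin K → ℝ, (∀ k, c k ∈ Set.Icc (0 : ℝ) 1) →
      FCR.IsWeightMap (M := M) c (FCR.eventWeights c) ∧
      FCR.IsWeightMap (M := M) c (FCR.incrementWeights c) ∧
      ∃ rec : FCR.Bid K M → ℕ → ℕ → FCR.Coord K M → ℝ, ∀ b β,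
        rec b (FCR.price b β) (FCR.alloc b β) = FCR.outcome (FCR.incrementWeights c) b β) ∧
    (∀ c : Fin K → ℝ, (∀ k, c k ∈ Set.Icc (0 : ℝ) 1) →
      ∀ D : PMF (FCR.Bid K M),
      (∃ b₀ : FCR.Bid K M, ∀ b, b ≠ b₀ →
        FCR.expect D (fun β => FCR.utility c b β) < FCR.expect D (fun β => FCR.utility c b₀ β)) →
      ∃ C : ℝ, ∀ W : FCR.Bid K M → FCR.Coord K M → ℝ, FCR.IsWeightMap c W →
        ∀ (P : FCR.SamplingScheme K M) (T : ℕ), 2 ≤ T →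
          FCR.pseudoRegret c γ W P D T ≤ C * Real.log T) ∧
    (∃ C : ℝ, ∀ c : Fin K → ℝ, (∀ k, c k ∈ Set.Icc (0 : ℝ) 1) →
      ∀ W : FCR.Bid K M → FCR.Coord K M → ℝ, FCR.IsWeightMap c W →
        ∀ (P : FCR.SamplingScheme K M) (β : ℕ → FCR.Bid K M) (T : ℕ), 1 ≤ T →
          FCR.regret c γ W P β T ≤ C * √(T : ℝ)) := by
  refine ⟨fun c hc => ⟨FCR.isWeightMap_eventWeights hc, FCR.isWeightMap_incrementWeights hc,
    FCR.recoverIncrements c, FCR.recoverIncrements_eq c⟩, ?_, ?_⟩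
  · rintro c - D ⟨b₀, hb₀⟩
    obtain ⟨δ, hδ, hgap⟩ := FCR.exists_uniform_gap b₀
      (fun b => FCR.expect D (fun β => FCR.utility c b₀ β) -
        FCR.expect D (fun β => FCR.utility c b β)) fun b hb => sub_pos.mpr (hb₀ b hb)
    exact ⟨_, fun W hW P T hT => FCR.pseudoRegret_le_log hM hγ0 hγ1 hW P D hδ hgap hT⟩
  · exact ⟨_, fun c _ W hW P β T _ => FCR.regret_le_sqrt hM hγ0 hγ1 hW P β T⟩
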